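/- **Continuous problem.** Let $X$, $Y$ be complex Banach spaces, $A:D(A)\subset X\to X$ linear with $D(A)$ dense, $\partial:D(A)\to Y$ linear, $T>0$, and let $u$ solve $u'=Au+f$, $u(0)=u_0$, $\partial u=g$ on $[0,T]$. Assume: (A1) $\partial$ is onto; (A2) $\ker\partial$ is dense in $X$ and $A_0=A|_{\ker\partial}$ generates a $C_0$-semigroup $e^{tA_0}$ of negative type $\omega$; (A3) for $\mathrm{Re}\,z>\omega$ and $v\in Y$ the problem $Ax=zx$, $\partial x=v$ has a unique solution $x=K(z)v$, and for some $\omega_0>\omega$ and $L$ one has $\|K(z)v\|\le L\|v\|$ whenever $\mathrm{Re}\,z>\omega_0$. Put $\varphi_0(tA_0)=e^{tA_0}$ and $\varphi_j(tA_0)=t^{-j}\int_0^t e^{(t-\tau)A_0}\frac{\tau^{j-1}}{(j-1)!}\,d\tau$ for $j\ge1$, $t>0$. Let $p\ge1$ and let $u\in C^j([0,T],D(A^{p+1-j}))$ for $0\le j\le p+1$, in the sense that $u^{(j)}(t)\in D(A^{p+1-j})$, that $A^qu^{(j)}\in C([0,T],X)$ for $j+q\le p+1$, and that $(A^qu^{(j)})'=A^qu^{(j+1)}$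 for $j+q\le p$. **Time discretization.** Let $c_1,\dots,c_s\in[0,1]$ be distinct nodes with Lagrange polynomials $l_i(\theta)=\sum_{j=1}^s a_{i,j}\frac{\theta^{j-1}}{(j-1)!}$. For a step $k>0$ put $t_n=nk$ and, for $t_{n+1}\le T$, $$\bar u_{n+1}=\sum_{l=0}^p\frac{k^l}{l!}A^lu(t_n)+k^{p+1}\varphi_{p+1}(kA_0)A^{p+1}u(t_n)+k\sum_{i,j=1}^sa_{i,j}\Big[\sum_{l=0}^{p-1}\frac{k^l}{(l+j)!}A^lf(t_n+c_ik)+k^p\varphi_{p+j}(kA_0)A^pf(t_n+c_ik)\Big],$$ and $\rho_n=u(t_{n+1})-\bar u_{n+1}$. **Space discretization.** For each $h$ in a sequence of positive numbers tending to $0$ let $X_{h,0}\subset X_h\subset X$ be finite-dimensional subspaces, $\|\cdot\|_h$ a norm on $X_h$, $A_h:X_h\to X_{h,0}$ and $Q_h:Y\to X_h$ linear, $A_{h,0}:X_{h,0}\to X_{h,0}$ linear and invertible, and $L_h:X\to X_{h,0}$ a bounded projection. For $w\in D(A)$ define $R_hw$ by $A_{h,0}R_hw+A_hQ_h\partial w=L_hAw$,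 and put $P_hw=L_hw-L_hQ_h\partial w$. Let $Z$ be a Banach space continuously embedded in $X$ such that $A_0^{-1}Z\subset Z$ and, for every $z\in Z$, $t\mapsto A_0^{-(p-1)}e^{tA_0}z$ belongs to $C([0,T],Z)$. Assume that, uniformly in $h$ (and $t\ge0$), $e^{tA_{h,0}}$, $A_{h,0}^{-1}$, $L_h$ and $L_hQ_h$ are bounded; that $\|A_{h,0}(R_h-P_h)z\|_h\le\varepsilon_h\|z\|_Z$ for $z\in Z\cap D(A)$, with $\varepsilon_h\ge0$ decreasing with $h$; and that (HS) $A_{h,0}^{-1}A_hQ_h$ is bounded independently of $h$ for small $h$. **Full discretization.** Let $\hat v_{n,0}(\tau)=\sum_{l=0}^p\frac{\tau^l}{l!}A^lu(t_n)$ and $\hat v_{j,n,i}(\tau)=\sum_{l=0}^{p-1}\frac{\tau^l}{(l+j)!}A^lf(t_n+c_ik)$. Let $\bar V_{h,n,0}$ be the solution on $[0,k]$ of $$\bar V'+L_hQ_h\partial\hat v_{n,0}'=A_{h,0}\bar V+A_hQ_h\partial\hat v_{n,0},\qquad \bar V(0)=R_hu(t_n),$$ and $\bar V_{h,j,n,i}$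 the continuous solution on $[0,k]$ (equation for $\tau>0$) of $$\bar V'=\Big(A_{h,0}-\frac j\tau\Big)\bar V+A_hQ_h\partial\hat v_{j,n,i}+\frac{R_hf(t_n+c_ik)}{(j-1)!\,\tau}+L_hQ_h\partial\Big[\frac{f(t_n+c_ik)}{(j-1)!\,\tau}-\frac j\tau\hat v_{j,n,i}-\hat v_{j,n,i}'\Big],\qquad \bar V(0)=\frac1{j!}R_hf(t_n+c_ik).$$ Put $\bar U_{h,n+1}=\bar V_{h,n,0}(k)+k\sum_{i,j=1}^sa_{i,j}\bar V_{h,j,n,i}(k)$ and $\rho_{h,n}=R_hu(t_{n+1})-\bar U_{h,n+1}$. **Theorem.** Assume in addition $A^ju\in C([0,T],Z)$ for $0\le j\le p+1$ and $A^jf\in C([0,T],Z)$ for $0\le j\le p$. Then, with constants $C$ independent of $h$, $k$ and $n$ (for all $h$ in the sequence, $k>0$ and $n\ge0$ with $t_{n+1}\le T$): 1. If the operators $P_h$ are bounded uniformly in $h$, i.e. $\|P_hx\|_h\le M\|x\|$ for $x\in D(A)$ with $M$ independent of $h$ (in particular if $L_hQ_h\partial\equiv0$), then $\|\rho_{h,n}\|_h\le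 C\,(k\varepsilon_h+\|\rho_n\|)$. 2. Without this boundedness of $P_h$, $\|\rho_{h,n}\|_h\le C\,(k\varepsilon_h+\|\rho_n\|+\|\partial\rho_n\|_Y)$. 3. $\displaystyle\Big\|\rho_n-\sum_{m=1}^pk^m\sum_{r=0}^{m-1}\Big(\frac1{m!}-\frac1{r!}\sum_{l=1}^s\frac1{(m-r-1+l)!}\sum_{i=1}^sc_i^ra_{i,l}\Big)A^{m-r-1}f^{(r)}(t_n)\Big\|\le Ck^{p+1}$. 4. If the interpolatory quadrature rule on $[0,1]$ with nodes $c_i$ is exact for polynomials of degree $\le p-1$, then $\|\rho_n\|\le Ck^{p+1}$. -/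

import Mathlib

open Filter Topology

noncomputable section

namespace ExpQuad

/-! ### Unbounded operators -/

section Operators

variable {X Y : Type*} [AddCommGroup X] [Module ℂ X] [AddCommGroup Y] [Module ℂ Y]

open Classical in
/-- The value of a partially defined operator, extended by `0` outside its domain.  Every use
below is guarded by a membership in the domain (see `DomPow`), or is on elements which are in the
domain because of the hypotheses. -/
def app (B : X →ₗ.[ℂ] X) (x : X) : X :=
  if hx : x ∈ B.domain then B ⟨x, hx⟩ else 0

open Classical in
/-- The boundary value `∂ x` of `x ∈ D(A)`, extended by `0` outside `D(A)`. -/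
def bdry {A : X →ₗ.[ℂ] X} (bd : A.domain →ₗ[ℂ] Y) (x : X) : Y :=
  if hx : x ∈ A.domain then bd ⟨x, hx⟩ else 0

/-- `x ∈ D(B ^ m)`: all of `x, B x, …, B ^ (m - 1) x` are in `D(B)`. -/
def DomPow (B : X →ₗ.[ℂ] X) (m : ℕ) (x : X) : Prop :=
  ∀ i < m, (app B)^[i] x ∈ B.domain

/-- `A₀`, the restriction of `A` to `ker ∂`. -/
def kerRestrict (A : X →ₗ.[ℂ] X) (bd : A.domain →ₗ[ℂ] Y) : X →ₗ.[ℂ] X :=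
  A.domRestrict ((LinearMap.ker bd).map A.domain.subtype)

end Operators

/-! ### Strongly continuous semigroups and their `φ`-functions -/

section Semigroups

variable {X : Type*} [NormedAddCommGroup X] [NormedSpace ℂ X]

/-- `C₀`-semigroups of bounded operators on `X` (only the values at `t ≥ 0` matter). -/
structure C0Semigroup (X : Type*) [NormedAddCommGroup X] [NormedSpace ℂ X] where
  /-- the operator at time `t` -/
  op : ℝ → X →L[ℂ] X
  op_zero : op 0 = ContinuousLinearMap.id ℂ X
  op_add : ∀ s t : ℝ, 0 ≤ s → 0 ≤ t → op (s + t) = (op s).comp (op t)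
  continuousOn : ∀ x : X, ContinuousOn (fun t => op t x) (Set.Ici 0)

/-- `B` (with exactly its domain) is the infinitesimal generator of `S`. -/
def C0Semigroup.IsGenerator (S : C0Semigroup X) (B : X →ₗ.[ℂ] X) : Prop :=
  ∀ x y : X, (x, y) ∈ B.graph ↔
    Tendsto (fun t : ℝ => t⁻¹ • (S.op t x - x)) (𝓝[>] 0) (𝓝 y)

/-- The type (growth bound) of the semigroup, in `[-∞, ∞]`: the infimum of all real `r` such that
`‖S t‖ ≤ M exp (r t)` for some `M` and all `t ≥ 0`. -/
def C0Semigroup.type (S : C0Semigroup X) : EReal :=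
  sInf {w : EReal | ∃ r M : ℝ, w = (r : EReal) ∧ ∀ t : ℝ, 0 ≤ t → ‖S.op t‖ ≤ M * Real.exp (r * t)}

/-- `φ_j(t A₀) x` for `t > 0`, where `A₀` is the generator of `S`:
`φ_0(t A₀) = S t` and, for `j ≥ 1`,
`φ_j(t A₀) x = t^{-j} ∫_0^t S(t - τ) x τ^{j-1}/(j-1)! dτ`. -/
def C0Semigroup.phi (S : C0Semigroup X) : ℕ → ℝ → X → X
  | 0, t, x => S.op t x
  | j + 1, t, x =>
      (1 / t ^ (j + 1)) • ∫ τ in (0 : ℝ)..t, (τ ^ j / (j.factorial : ℝ)) • S.op (t - τ) x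

end Semigroups

/-! ### The abstract initial boundary value problem -/

section Problem

variable {X Y : Type*} [NormedAddCommGroup X] [NormedSpace ℂ X]
  [NormedAddCommGroup Y] [NormedSpace ℂ Y]

/-- The assumptions (A1), (A2), (A3) on `A`, `∂` and the semigroup `S = (e^{t A₀})`. -/
structure IsAbstractIBVP (A : X →ₗ.[ℂ] X) (bd : A.domain →ₗ[ℂ] Y) (S : C0Semigroup X) : Prop where
  dense_domain : Dense (A.domain : Set X)
  bd_surjective : Function.Surjective bd
  dense_ker : Dense ((kerRestrict A bd).domain : Set X)
  generator : S.IsGenerator (kerRestrict A bd)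
  type_neg : S.type < 0
  steady_existsUnique : ∀ z : ℂ, S.type < ((z.re : ℝ) : EReal) → ∀ v : Y,
    ∃! x : A.domain, A x = z • (x : X) ∧ bd x = v
  steady_bound : ∃ ω₀ L : ℝ, S.type < (ω₀ : EReal) ∧ ∀ z : ℂ, ω₀ < z.re →
    ∀ (v : Y) (x : A.domain), A x = z • (x : X) → bd x = v → ‖(x : X)‖ ≤ L * ‖v‖

/-- `u' = A u + f` on `[0, T]`, `u(0) = u₀`, `∂ u = g`. -/
structure IsSolution (A : X →ₗ.[ℂ] X) (bd : A.domain →ₗ[ℂ] Y) (T : ℝ)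
    (f : ℝ → X) (g : ℝ → Y) (u₀ : X) (u : ℝ → X) : Prop where
  mem_domain : ∀ t ∈ Set.Icc 0 T, u t ∈ A.domain
  hasDeriv : ∀ t ∈ Set.Icc 0 T, HasDerivWithinAt u (app A (u t) + f t) (Set.Icc 0 T) t
  initial : u 0 = u₀
  boundary : ∀ t ∈ Set.Icc 0 T, bdry bd (u t) = g t

/-- The `r`-th time derivative on `[0, T]`. -/
def tderiv (T : ℝ) (r : ℕ) (u : ℝ → X) : ℝ → X :=
  iteratedDerivWithin r u (Set.Icc 0 T)

/-- `A^{p+1-j} u^{(j)} ∈ C([0,T], X)` for `0 ≤ j ≤ p + 1`, that is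
`u ∈ C^j([0,T], D(A^{p+1-j}))`, the differentiability being with respect to the graph norms:
`A^q u^{(j)}` is continuous for `j + q ≤ p + 1` and has the derivative `A^q u^{(j+1)}` for
`j + q ≤ p`. -/
structure TimeRegular (A : X →ₗ.[ℂ] X) (T : ℝ) (p : ℕ) (u : ℝ → X) : Prop where
  mem_domain : ∀ j ≤ p + 1, ∀ t ∈ Set.Icc 0 T, DomPow A (p + 1 - j) (tderiv T j u t)
  continuousOn : ∀ j q : ℕ, j + q ≤ p + 1 →
    ContinuousOn (fun t => (app A)^[q] (tderiv T j u t)) (Set.Icc 0 T)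
  hasDeriv : ∀ j q : ℕ, j + q ≤ p → ∀ t ∈ Set.Icc 0 T,
    HasDerivWithinAt (fun t => (app A)^[q] (tderiv T j u t))
      ((app A)^[q] (tderiv T (j + 1) u t)) (Set.Icc 0 T) t

variable {Z : Type*} [NormedAddCommGroup Z] [NormedSpace ℂ Z]

/-- `A^j u ∈ C([0,T], Z)` for `0 ≤ j ≤ m`, where `Z` is a subspace of `X` with its own norm
(`ι` is the inclusion). -/
def ZRegular (A : X →ₗ.[ℂ] X) (ι : Z →L[ℂ] X) (T : ℝ) (m : ℕ) (u : ℝ → X) : Prop :=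
  ∀ j ≤ m, ∃ w : ℝ → Z, ContinuousOn w (Set.Icc 0 T) ∧
    ∀ t ∈ Set.Icc 0 T, DomPow A j (u t) ∧ ι (w t) = (app A)^[j] (u t)

/-- The compatibility of `Z` with `A₀` and its semigroup: `A₀⁻¹ z ∈ Z` for `z ∈ Z`, and
`t ↦ A₀^{-(p-1)} e^{t A₀} z` is in `C([0,T], Z)` for `z ∈ Z`
(for `p = 1`: the semigroup restricts to a `C₀`-semigroup of `Z`). -/
structure IsCompatible (A₀ : X →ₗ.[ℂ] X) (S : C0Semigroup X) (ι : Z →L[ℂ] X) (T : ℝ) (p : ℕ) :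
    Prop where
  inv_mem : ∀ z : Z, ∃ w : Z, ι w ∈ A₀.domain ∧ app A₀ (ι w) = ι z
  orbit : ∀ z : Z, ∃ w : ℝ → Z, ContinuousOn w (Set.Icc 0 T) ∧
    ∀ t ∈ Set.Icc 0 T, DomPow A₀ (p - 1) (ι (w t)) ∧ (app A₀)^[p - 1] (ι (w t)) = S.op t (ι z)

end Problem

/-! ### The quadrature rule and the time semidiscretization -/

section Time

variable {X : Type*} [NormedAddCommGroup X] [NormedSpace ℂ X]

/-- The coefficients `a_{i,j}` with `l_i(θ) = ∑_{j=1}^s a_{i,j} θ^{j-1}/(j-1)!`, where `l_i` are the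
Lagrange polynomials of the nodes `c`.  The index `j : Fin s` stands for `j + 1`. -/
def coeffA {s : ℕ} (c : Fin s → ℝ) (i j : Fin s) : ℝ :=
  (Nat.factorial (j : ℕ) : ℝ) * (Lagrange.basis Finset.univ c i).coeff (j : ℕ)

/-- The interpolatory quadrature rule on `[0,1]` with nodes `c` is exact for all polynomials of
degree `< d`. -/
def QuadExact {s : ℕ} (c : Fin s → ℝ) (d : ℕ) : Prop :=
  ∀ P : Polynomial ℝ, P.degree < (d : WithBot ℕ) →
    ∫ θ in (0 : ℝ)..1, P.eval θ =
      ∑ i, (∫ θ in (0 : ℝ)..1, (Lagrange.basis Finset.univ c i).eval θ) * P.eval (c i)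

/-- The result of one step of length `k` of the time semidiscretization
from the value `v` at the time `t`. -/
def timeStep (A : X →ₗ.[ℂ] X) (S : C0Semigroup X) {s : ℕ} (c : Fin s → ℝ) (p : ℕ)
    (f : ℝ → X) (k t : ℝ) (v : X) : X :=
  (∑ l ∈ Finset.range (p + 1), (k ^ l / (l.factorial : ℝ)) • (app A)^[l] v)
    + k ^ (p + 1) • S.phi (p + 1) k ((app A)^[p + 1] v)
    + k • ∑ i, ∑ j : Fin s, coeffA c i j •
        ((∑ l ∈ Finset.range p,
            (k ^ l / ((l + (j + 1)).factorial : ℝ)) • (app A)^[l] (f (t + c i * k)))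
          + k ^ p • S.phi (p + (j + 1)) k ((app A)^[p] (f (t + c i * k))))

/-- The local error `ρ_n = u(t_{n+1}) - ū_{n+1}` of the time semidiscretization, `t_n = n k`. -/
def rho (A : X →ₗ.[ℂ] X) (S : C0Semigroup X) {s : ℕ} (c : Fin s → ℝ) (p : ℕ)
    (f u : ℝ → X) (k : ℝ) (n : ℕ) : X :=
  u ((n + 1) * k) - timeStep A S c p f k (n * k) (u (n * k))

end Time

/-! ### The space discretization -/

section Space

variable {X Y : Type*} [NormedAddCommGroup X] [NormedSpace ℂ X]
  [NormedAddCommGroup Y] [NormedSpace ℂ Y]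

/-- The exponential `e^B = ∑ B^n / n!` of a bounded operator. -/
def opExp {E : Type*} [NormedAddCommGroup E] [NormedSpace ℂ E] (B : E →L[ℂ] E) : E →L[ℂ] E :=
  NormedSpace.exp B

/-- The data of the space discretization for one value of `h`. -/
structure SpaceDisc (X Y : Type*) [NormedAddCommGroup X] [NormedSpace ℂ X]
    [NormedAddCommGroup Y] [NormedSpace ℂ Y] where
  /-- the space `X_h` -/
  Xh : Submodule ℂ X
  finite_Xh : FiniteDimensional ℂ Xh
  /-- the subspace `X_{h,0}` of `X_h` -/
  Xh0 : Submodule ℂ X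
  Xh0_le : Xh0 ≤ Xh
  /-- the norm `‖·‖_h` of `X_h` -/
  nrm : Seminorm ℂ Xh
  nrm_definite : ∀ x, nrm x = 0 → x = 0
  /-- `A_h` -/
  Ah : Xh →ₗ[ℂ] Xh0
  /-- `A_{h,0}`, which is invertible -/
  Ah0 : Xh0 ≃L[ℂ] Xh0
  /-- the projection `L_h` -/
  Lh : X →L[ℂ] Xh0
  Lh_proj : ∀ x : Xh0, Lh (x : X) = x
  /-- the discretization `Q_h` of boundary values -/
  Qh : Y →ₗ[ℂ] Xh

namespace SpaceDisc

/-- `‖x‖_h` for `x ∈ X_{h,0} ⊆ X_h`. -/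
def nrm0 (D : SpaceDisc X Y) (x : D.Xh0) : ℝ := D.nrm (Submodule.inclusion D.Xh0_le x)

/-- `L_h Q_h v` -/
def LQ (D : SpaceDisc X Y) (v : Y) : D.Xh0 := D.Lh (D.Qh v : X)

/-- `A_h Q_h v` -/
def AQ (D : SpaceDisc X Y) (v : Y) : D.Xh0 := D.Ah (D.Qh v)

/-- `e^{t A_{h,0}}` -/
def expAh0 (D : SpaceDisc X Y) (t : ℝ) : D.Xh0 →L[ℂ] D.Xh0 :=
  opExp ((t : ℂ) • (D.Ah0 : D.Xh0 →L[ℂ] D.Xh0))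

/-- The elliptic projection `R_h w` of `w ∈ D(A)`, the solution of
`A_{h,0} R_h w + A_h Q_h ∂ w = L_h A w`. -/
def Rh (D : SpaceDisc X Y) {A : X →ₗ.[ℂ] X} (bd : A.domain →ₗ[ℂ] Y) (w : X) : D.Xh0 :=
  D.Ah0.symm (D.Lh (app A w) - D.AQ (bdry bd w))

/-- `P_h w = L_h w - L_h Q_h ∂ w` for `w ∈ D(A)`. -/
def Ph (D : SpaceDisc X Y) {A : X →ₗ.[ℂ] X} (bd : A.domain →ₗ[ℂ] Y) (w : X) : D.Xh0 :=
  D.Lh w - D.LQ (bdry bd w)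

end SpaceDisc

variable {Z : Type*} [NormedAddCommGroup Z] [NormedSpace ℂ Z]

/-- The hypotheses on the space discretizations with the parameters `h i → 0`: the semigroups
`e^{t A_{h,0}}`, the inverses `A_{h,0}⁻¹`, `L_h` and `L_h Q_h` are bounded uniformly in `h`,
`‖A_{h,0}(R_h - P_h) z‖_h ≤ ε_h ‖z‖_Z` for `z ∈ Z`, with `ε_h` decreasing with `h`, and (HS). -/
structure IsSpaceDisc {A : X →ₗ.[ℂ] X} (bd : A.domain →ₗ[ℂ] Y) (ι : Z →L[ℂ] X)
    (D : ℕ → SpaceDisc X Y) (h ε : ℕ → ℝ) : Prop where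
  h_pos : ∀ i, 0 < h i
  h_tendsto : Tendsto h atTop (𝓝 0)
  eps_nonneg : ∀ i, 0 ≤ ε i
  eps_mono : ∀ i i', h i ≤ h i' → ε i ≤ ε i'
  exp_bdd : ∃ M : ℝ, ∀ (i : ℕ) (t : ℝ), 0 ≤ t → ∀ x : (D i).Xh0,
    (D i).nrm0 ((D i).expAh0 t x) ≤ M * (D i).nrm0 x
  inv_bdd : ∃ M : ℝ, ∀ (i : ℕ) (x : (D i).Xh0), (D i).nrm0 ((D i).Ah0.symm x) ≤ M * (D i).nrm0 x
  Lh_bdd : ∃ M : ℝ, ∀ (i : ℕ) (x : X), (D i).nrm0 ((D i).Lh x) ≤ M * ‖x‖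
  LQ_bdd : ∃ M : ℝ, ∀ (i : ℕ) (v : Y), (D i).nrm0 ((D i).LQ v) ≤ M * ‖v‖
  consistency : ∀ (i : ℕ) (z : Z), ι z ∈ A.domain →
    (D i).nrm0 ((D i).Ah0 ((D i).Rh bd (ι z) - (D i).Ph bd (ι z))) ≤ ε i * ‖z‖
  hs : ∃ M : ℝ, ∀ᶠ i in atTop, ∀ v : Y, (D i).nrm0 ((D i).Ah0.symm ((D i).AQ v)) ≤ M * ‖v‖

/-- The operators `P_h` are bounded uniformly in `h`. -/
def PhBounded {A : X →ₗ.[ℂ] X} (bd : A.domain →ₗ[ℂ] Y) (D : ℕ → SpaceDisc X Y) : Prop :=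
  ∃ M : ℝ, ∀ (i : ℕ), ∀ x ∈ A.domain, (D i).nrm0 ((D i).Ph bd x) ≤ M * ‖x‖

end Space

/-! ### The full discretization -/

section Full

variable {X Y : Type*} [NormedAddCommGroup X] [NormedSpace ℂ X]
  [NormedAddCommGroup Y] [NormedSpace ℂ Y]

/-- `∑_{l < m} τ^l/(l+j)! A^l α`. For `j = 0`, `m = p + 1`, `α = u(t_n)` this is `v̂_{n,0}`; for
`j ≥ 1`, `m = p`, `α = f(t_n + c_i k)` it is `v̂_{j,n,i}`. -/
def vhat (A : X →ₗ.[ℂ] X) (m j : ℕ) (α : X) (τ : ℝ) : X :=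
  ∑ l ∈ Finset.range m, (τ ^ l / ((l + j).factorial : ℝ)) • (app A)^[l] α

/-- `V` solves on `[0, k]` the problem which defines `V̄_{h,n,0}`, with `α = u(t_n)`:
`V' + L_h Q_h ∂ v̂' = A_{h,0} V + A_h Q_h ∂ v̂`, `V(0) = R_h α`. -/
structure IsVbar0 (D : SpaceDisc X Y) {A : X →ₗ.[ℂ] X} (bd : A.domain →ₗ[ℂ] Y) (p : ℕ) (α : X)
    (k : ℝ) (V : ℝ → D.Xh0) : Prop where
  initial : V 0 = D.Rh bd α
  hasDeriv : ∀ τ ∈ Set.Icc 0 k, HasDerivWithinAt V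
    (D.Ah0 (V τ) + D.AQ (bdry bd (vhat A (p + 1) 0 α τ))
      - D.LQ (bdry bd (deriv (vhat A (p + 1) 0 α) τ))) (Set.Icc 0 k) τ

/-- `V` solves on `[0, k]` the problem which defines `V̄_{h,j,n,i}` (`j ≥ 1`), with
`α = f(t_n + c_i k)`:
`V' = (A_{h,0} - j/τ) V + A_h Q_h ∂ v̂ + R_h α / ((j-1)! τ)
  + L_h Q_h ∂ [α / ((j-1)! τ) - (j/τ) v̂ - v̂']` for `τ > 0`, `V(0) = R_h α / j!`. -/
structure IsVbar (D : SpaceDisc X Y) {A : X →ₗ.[ℂ] X} (bd : A.domain →ₗ[ℂ] Y) (p j : ℕ) (α : X)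
    (k : ℝ) (V : ℝ → D.Xh0) : Prop where
  initial : V 0 = (1 / (j.factorial : ℝ)) • D.Rh bd α
  continuousOn : ContinuousOn V (Set.Icc 0 k)
  hasDeriv : ∀ τ ∈ Set.Ioc 0 k, HasDerivWithinAt V
    (D.Ah0 (V τ) - ((j : ℝ) / τ) • V τ + D.AQ (bdry bd (vhat A p j α τ))
      + (1 / (((j - 1).factorial : ℝ) * τ)) • D.Rh bd α
      + D.LQ (bdry bd ((1 / (((j - 1).factorial : ℝ) * τ)) • α
          - ((j : ℝ) / τ) • vhat A p j α τ - deriv (vhat A p j α) τ))) (Set.Icc 0 k) τ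

/-- `r = ρ_{h,n} = R_h u(t_{n+1}) - Ū_{h,n+1}` is the local error of the full discretization, with
`Ū_{h,n+1} = V̄_{h,n,0}(k) + k ∑_{i,j} a_{i,j} V̄_{h,j,n,i}(k)`. -/
def IsFullLocalError (D : SpaceDisc X Y) {A : X →ₗ.[ℂ] X} (bd : A.domain →ₗ[ℂ] Y) {s : ℕ}
    (c : Fin s → ℝ) (p : ℕ) (f u : ℝ → X) (k : ℝ) (n : ℕ) (r : D.Xh0) : Prop :=
  ∃ (V₀ : ℝ → D.Xh0) (V : Fin s → Fin s → ℝ → D.Xh0),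
    IsVbar0 D bd p (u (n * k)) k V₀ ∧
    (∀ i j : Fin s, IsVbar D bd p (j + 1) (f (n * k + c i * k)) k (V i j)) ∧
    r = D.Rh bd (u ((n + 1) * k)) - (V₀ k + k • ∑ i, ∑ j, coeffA c i j • V i j k)

end Full

end ExpQuad

end

/-!
# Local errors of exponential quadrature rules for initial boundary value problems

The semidiscrete step is a combination of the exact solutions
`v(τ) = v̂(τ) + τ^m φ_{m+j}(τ A₀) A^m α` (`ExpQuad.exactV`) of auxiliary problems in `X`, where `α` is
a value of `u` (with `m = p + 1`, `j = 0`) or of `f` (with `m = p`, `j ≥ 1`).  The full discretization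
solves the space discretizations of the same problems.  The defect of the discretization at `v`
consists of terms `A_{h,0} (R_h - P_h) v` and, for `j ≥ 1`, of `(R_h - P_h) α / τ`.  The factor `1/τ`
is harmless: `τ^j (V - P_h v)` starts from `0` and satisfies an evolution equation without singular
terms (`ExpQuad.SpaceDisc.Bounds.vbar_hasDerivWithinAt`), so that stability of `e^{tA_{h,0}}` gives a
bound of order `τ^j ε_h`.  For `j = 0` one subtracts `(R_h - P_h) α` in addition and obtains the
order `k ε_h` (`ExpQuad.SpaceDisc.Bounds.vbar0_error`).

These consistency bounds need `v` to be bounded in `Z`, uniformly in `τ`.  The operator `A₀⁻¹` exists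
because `(∫₀ᵗ S(σ) dσ) (S(t) - 1)⁻¹` is a right inverse of the generator when `‖S(t)‖ < 1`
(`ExpQuad.C0Semigroup.IsGenerator.exists_right_inverse`); it is bounded on `Z` by the closed graph
theorem, and the operators `A₀^{-(p-1)} e^{tA₀}` are uniformly bounded there by Banach-Steinhaus.
The powers of `A₀⁻¹` are then exchanged for powers of `t` by the recurrence
`t A₀ φ_{N+1}(t A₀) = φ_N(t A₀) - 1/N!` (`ExpQuad.IsCompatible.exists_pow_phi_mem`).

As `R_h` is linear on `D(A)`, it follows that `ρ_{h,n} = R_h ρ_n + O(k ε_h)`.  Moreover `ρ_n` is of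
order `k` in `Z` (`ExpQuad.exists_rho_mem`), hence `R_h ρ_n = P_h ρ_n + O(k ε_h)`.  What is left is
`P_h ρ_n = L_h ρ_n - L_h Q_h ∂ρ_n` (`ExpQuad.exists_full_error_bound`), which is bounded by `‖ρ_n‖`, or
by `‖ρ_n‖ + ‖∂ρ_n‖`.

The expansion of `ρ_n` follows from Taylor's formula for `u` and for `A^l f`, together with
`u^{(m)} = A^m u + ∑_{r<m} A^{m-r-1} f^{(r)}` (`ExpQuad.exists_rho_expansion`).  Up to a factor, its
coefficients are the integrals of `(1-θ)^{m-r-1} (θ^r - I θ^r)`, with `I` the interpolation at the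
nodes.  This polynomial vanishes at the nodes, so an exact quadrature rule gives the integral `0`
(`ExpQuad.orderCoeff_eq_zero`).
-/

noncomputable section

namespace ExpQuad

/-! ### Linearity of partially defined operators on their domain -/

section LinearOn

variable {X Y E F : Type*} [AddCommGroup X] [Module ℂ X] [AddCommGroup Y] [Module ℂ Y]
  [AddCommGroup E] [Module ℂ E] [AddCommGroup F] [Module ℂ F]

/-- `F` is real linear on the subspace `p`; its values outside `p` are irrelevant. -/
structure IsLinearOn (p : Submodule ℂ X) (F : X → E) : Prop where
  add : ∀ x ∈ p, ∀ y ∈ p, F (x + y) = F x + F y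
  smul : ∀ (r : ℝ), ∀ x ∈ p, F (r • x) = r • F x

lemma real_smul_mem (p : Submodule ℂ X) (r : ℝ) {x : X} (hx : x ∈ p) : r • x ∈ p :=
  p.smul_of_tower_mem r hx

namespace IsLinearOn

variable {p : Submodule ℂ X} {G H : X → E}

lemma zero (hG : IsLinearOn p G) : G 0 = 0 := by
  simpa using hG.smul 0 0 p.zero_mem

lemma sub (hG : IsLinearOn p G) {x y : X} (hx : x ∈ p) (hy : y ∈ p) :
    G (x - y) = G x - G y := by
  have h1 := hG.add x hx ((-1 : ℝ) • y) (real_smul_mem p _ hy)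
  rw [hG.smul (-1) y hy] at h1
  simpa [sub_eq_add_neg] using h1

lemma sum (hG : IsLinearOn p G) {α : Type*} (s : Finset α) (r : α → ℝ) (x : α → X)
    (hx : ∀ a ∈ s, x a ∈ p) : G (∑ a ∈ s, r a • x a) = ∑ a ∈ s, r a • G (x a) := by
  classical
  induction s using Finset.induction_on with
  | empty => simpa using hG.zero
  | insert a s ha ih =>
    rw [Finset.sum_insert ha, Finset.sum_insert ha, hG.add, hG.smul,
      ih fun b hb => hx b (Finset.mem_insert_of_mem hb)]
    · exact hx a (Finset.mem_insert_self a s)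
    · exact real_smul_mem p _ (hx a (Finset.mem_insert_self a s))
    · exact p.sum_mem fun b hb => real_smul_mem p _ (hx b (Finset.mem_insert_of_mem hb))

lemma comp (hG : IsLinearOn p G) (L : E →ₗ[ℂ] F) : IsLinearOn p fun x => L (G x) where
  add x hx y hy := by rw [hG.add x hx y hy, map_add]
  smul r x hx := by rw [hG.smul r x hx, LinearMap.map_smul_of_tower]

lemma sub_fun (hG : IsLinearOn p G) (hH : IsLinearOn p H) : IsLinearOn p fun x => G x - H x where
  add x hx y hy := by rw [hG.add x hx y hy, hH.add x hx y hy]; abel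
  smul r x hx := by rw [hG.smul r x hx, hH.smul r x hx, smul_sub]

end IsLinearOn

lemma isLinearOn_linearMap (p : Submodule ℂ X) (L : X →ₗ[ℂ] E) : IsLinearOn p L where
  add x _ y _ := map_add L x y
  smul r x _ := L.map_smul_of_tower r x

lemma app_of_mem (B : X →ₗ.[ℂ] X) {x : X} (hx : x ∈ B.domain) : app B x = B ⟨x, hx⟩ := dif_pos hx

lemma bdry_of_mem {A : X →ₗ.[ℂ] X} (bd : A.domain →ₗ[ℂ] Y) {x : X} (hx : x ∈ A.domain) :
    bdry bd x = bd ⟨x, hx⟩ := dif_pos hx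

lemma isLinearOn_bdry {A : X →ₗ.[ℂ] X} (bd : A.domain →ₗ[ℂ] Y) :
    IsLinearOn A.domain (bdry bd) where
  add x hx y hy := by
    rw [bdry_of_mem bd hx, bdry_of_mem bd hy, bdry_of_mem bd (A.domain.add_mem hx hy), ← map_add]
    rfl
  smul r x hx := by
    rw [bdry_of_mem bd hx, bdry_of_mem bd (real_smul_mem _ r hx), ← LinearMap.map_smul_of_tower]
    rfl

lemma isLinearOn_app (A : X →ₗ.[ℂ] X) : IsLinearOn A.domain (app A) := isLinearOn_bdry A.toFun

lemma domPow_of_le {B : X →ₗ.[ℂ] X} {m n : ℕ} {x : X} (h : DomPow B n x) (hmn : m ≤ n) :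
    DomPow B m x := fun i hi => h i (hi.trans_le hmn)

lemma iterate_app_sub {B : X →ₗ.[ℂ] X} {m : ℕ} {x y : X} (hx : DomPow B m x) (hy : DomPow B m y) :
    (app B)^[m] (x - y) = (app B)^[m] x - (app B)^[m] y := by
  induction m with
  | zero => rfl
  | succ m ih =>
    rw [Function.iterate_succ_apply', Function.iterate_succ_apply', Function.iterate_succ_apply',
      ih (domPow_of_le hx m.le_succ) (domPow_of_le hy m.le_succ),
      (isLinearOn_app B).sub (hx m m.lt_succ_self) (hy m m.lt_succ_self)]

lemma mem_kerRestrict_domain {A : X →ₗ.[ℂ] X} (bd : A.domain →ₗ[ℂ] Y) {x : X} :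
    x ∈ (kerRestrict A bd).domain ↔ x ∈ A.domain ∧ bdry bd x = 0 := by
  constructor
  · rintro ⟨⟨y, hy, rfl⟩, hx⟩
    exact ⟨hx, (bdry_of_mem bd hx).trans hy⟩
  · rintro ⟨hx, h0⟩
    exact ⟨⟨⟨x, hx⟩, (bdry_of_mem bd hx).symm.trans h0, rfl⟩, hx⟩

lemma app_kerRestrict {A : X →ₗ.[ℂ] X} (bd : A.domain →ₗ[ℂ] Y) {x : X}
    (hx : x ∈ (kerRestrict A bd).domain) : app (kerRestrict A bd) x = app A x := by
  have hx' := ((mem_kerRestrict_domain bd).1 hx).1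
  rw [app_of_mem _ hx, app_of_mem _ hx']
  exact LinearPMap.domRestrict_apply (x := ⟨x, hx⟩) rfl

lemma mem_graph_iff_app (B : X →ₗ.[ℂ] X) {x y : X} :
    (x, y) ∈ B.graph ↔ x ∈ B.domain ∧ app B x = y := by
  rw [LinearPMap.mem_graph_iff]
  constructor
  · rintro ⟨⟨z, hz⟩, rfl, h⟩
    exact ⟨hz, (app_of_mem B hz).trans h⟩
  · rintro ⟨hx, h⟩
    exact ⟨⟨x, hx⟩, rfl, (app_of_mem B hx).symm.trans h⟩

end LinearOn

/-! ### Iterated antiderivatives -/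

section IterInt

variable {E F : Type*} [NormedAddCommGroup E] [NormedSpace ℝ E]

/-- The `m`-fold antiderivative of `g` which vanishes at `0` together with its derivatives of
order `< m`. -/
def iterInt (g : ℝ → E) : ℕ → ℝ → E
  | 0, t => g t
  | m + 1, t => ∫ σ in (0 : ℝ)..t, iterInt g m σ

lemma iterInt_antideriv (g : ℝ → E) (m : ℕ) :
    iterInt (fun t => ∫ σ in (0 : ℝ)..t, g σ) m = iterInt g (m + 1) := by
  induction m with
  | zero => rfl
  | succ m ih => funext t; simp only [iterInt]; rw [ih]; rfl

lemma continuous_iterInt {g : ℝ → E} (hg : Continuous g) (m : ℕ) : Continuous (iterInt g m) := by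
  induction m with
  | zero => exact hg
  | succ m ih => exact intervalIntegral.continuous_primitive (fun a b => ih.intervalIntegrable a b) 0

lemma hasDerivAt_iterInt [CompleteSpace E] {g : ℝ → E} (hg : Continuous g) (m : ℕ) (t : ℝ) :
    HasDerivAt (iterInt g (m + 1)) (iterInt g m t) t :=
  ((continuous_iterInt hg m).integral_hasStrictDerivAt 0 t).hasDerivAt

/-- Cauchy's formula for repeated integration. -/
lemma iterInt_succ_eq [CompleteSpace E] {g : ℝ → E} (hg : Continuous g) (m : ℕ) (t : ℝ) :
    iterInt g (m + 1) t = ∫ τ in (0 : ℝ)..t, (τ ^ m / (m.factorial : ℝ)) • g (t - τ) := by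
  induction m generalizing g with
  | zero =>
    have := intervalIntegral.integral_comp_sub_left (a := 0) (b := t) g t
    simp [iterInt, this]
  | succ m ih =>
    have hG : Continuous fun t => ∫ σ in (0 : ℝ)..t, g σ := continuous_iterInt hg 1
    rw [← iterInt_antideriv, ih hG]
    have hu : ∀ τ ∈ Set.uIcc 0 t, HasDerivAt (fun τ : ℝ => τ ^ (m + 1) / ((m + 1).factorial : ℝ))
        (τ ^ m / (m.factorial : ℝ)) τ := by
      intro τ _
      have h := (hasDerivAt_pow (m + 1) τ).div_const ((m + 1).factorial : ℝ)
      refine h.congr_deriv ?_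
      have h1 : (m.factorial : ℝ) ≠ 0 := by positivity
      rw [Nat.factorial_succ]
      push_cast
      field_simp
    have hv : ∀ τ ∈ Set.uIcc 0 t, HasDerivAt (fun τ : ℝ => ∫ σ in (0 : ℝ)..(t - τ), g σ)
        (-g (t - τ)) τ := by
      intro τ _
      have h := (hg.integral_hasStrictDerivAt 0 (t - τ)).hasDerivAt
      have h2 : HasDerivAt (fun τ : ℝ => t - τ) (-1) τ := by
        simpa using (hasDerivAt_id τ).const_sub t
      simpa [Function.comp_def] using h.scomp τ h2
    have key := intervalIntegral.integral_smul_deriv_eq_deriv_smul hu hv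
      (Continuous.intervalIntegrable (by fun_prop) _ _)
      (Continuous.intervalIntegrable (by fun_prop) _ _)
    simp only [sub_self, intervalIntegral.integral_same, smul_zero, smul_neg,
      intervalIntegral.integral_neg, sub_zero] at key
    simpa using key.symm

lemma norm_iterInt_le {g : ℝ → E} {T C : ℝ} (hC : ∀ t ∈ Set.Icc 0 T, ‖g t‖ ≤ C)
    (m : ℕ) {t : ℝ} (ht : t ∈ Set.Icc 0 T) : ‖iterInt g m t‖ ≤ C * t ^ m := by
  induction m generalizing t with
  | zero => simpa [iterInt] using hC t ht
  | succ m ih =>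
    have hC0 : 0 ≤ C := (norm_nonneg _).trans (hC t ht)
    have h := intervalIntegral.norm_integral_le_of_norm_le_const (a := 0) (b := t) (C := C * t ^ m)
      (f := iterInt g m) fun σ hσ => by
        rw [Set.uIoc_of_le ht.1] at hσ
        refine (ih ⟨hσ.1.le, hσ.2.trans ht.2⟩).trans ?_
        have := hσ.1.le
        have := hσ.2
        gcongr
    rw [sub_zero, abs_of_nonneg ht.1] at h
    calc _ ≤ C * t ^ m * t := h
      _ = _ := by ring

lemma map_iterInt [NormedAddCommGroup F] [NormedSpace ℝ F] [CompleteSpace E] [CompleteSpace F]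
    (L : E →L[ℝ] F) {g : ℝ → E} (hg : Continuous g) (m : ℕ) (t : ℝ) :
    L (iterInt g m t) = iterInt (fun σ => L (g σ)) m t := by
  induction m generalizing t with
  | zero => rfl
  | succ m ih =>
    simp only [iterInt]
    rw [← L.intervalIntegral_comp_comm ((continuous_iterInt hg m).intervalIntegrable 0 t)]
    simp only [ih]

lemma iterInt_congr {g₁ g₂ : ℝ → E} {T : ℝ} (h : ∀ t ∈ Set.Icc 0 T, g₁ t = g₂ t) (m : ℕ) {t : ℝ}
    (ht : t ∈ Set.Icc 0 T) : iterInt g₁ m t = iterInt g₂ m t := by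
  induction m generalizing t with
  | zero => exact h t ht
  | succ m ih =>
    refine intervalIntegral.integral_congr fun σ hσ => ?_
    rw [Set.uIcc_of_le ht.1] at hσ
    exact ih ⟨hσ.1, hσ.2.trans ht.2⟩

end IterInt

/-! ### Exponentially stable semigroups -/

section Semigroup

variable {X Y : Type*} [NormedAddCommGroup X] [NormedSpace ℂ X]
  [NormedAddCommGroup Y] [NormedSpace ℂ Y]

lemma C0Semigroup.exists_norm_le (S : C0Semigroup X) (hS : S.type < 0) :
    ∃ r M : ℝ, r < 0 ∧ ∀ t : ℝ, 0 ≤ t → ‖S.op t‖ ≤ M * Real.exp (r * t) := by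
  obtain ⟨w, ⟨r, M, rfl, h⟩, hw⟩ := sInf_lt_iff.1 hS
  exact ⟨r, M, by exact_mod_cast hw, h⟩

/-- The orbit `t ↦ S(t) x`, extended to negative times by the constant `x`. -/
def C0Semigroup.orbit (S : C0Semigroup X) (x : X) (t : ℝ) : X := S.op (max t 0) x

lemma C0Semigroup.continuous_orbit (S : C0Semigroup X) (x : X) : Continuous (S.orbit x) :=
  (S.continuousOn x).comp_continuous (continuous_id.max continuous_const) fun t => le_max_right t 0

lemma C0Semigroup.orbit_of_nonneg (S : C0Semigroup X) (x : X) {t : ℝ} (ht : 0 ≤ t) :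
    S.orbit x t = S.op t x := by rw [orbit, max_eq_left ht]

/-- As an antiderivative, `t^m φ_m(t A₀) x` makes sense at `t = 0` too and is differentiable. -/
lemma C0Semigroup.pow_smul_phi [CompleteSpace X] (S : C0Semigroup X) (m : ℕ) {t : ℝ} (ht : 0 < t) (x : X) :
    t ^ m • S.phi m t x = iterInt (S.orbit x) m t := by
  cases m with
  | zero => simp [phi, iterInt, S.orbit_of_nonneg x ht.le]
  | succ m =>
    rw [iterInt_succ_eq (S.continuous_orbit x), phi, smul_smul,
      mul_one_div_cancel (pow_ne_zero _ ht.ne'), one_smul]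
    refine intervalIntegral.integral_congr fun τ hτ => ?_
    rw [Set.uIcc_of_le ht.le] at hτ
    rw [S.orbit_of_nonneg x (sub_nonneg.2 hτ.2)]

lemma C0Semigroup.phi_eq [CompleteSpace X] (S : C0Semigroup X) (m : ℕ) {t : ℝ} (ht : 0 < t) (x : X) :
    S.phi m t x = (t ^ m)⁻¹ • iterInt (S.orbit x) m t := by
  rw [← S.pow_smul_phi m ht, inv_smul_smul₀ (pow_ne_zero _ ht.ne')]

lemma C0Semigroup.norm_phi_le [CompleteSpace X] (S : C0Semigroup X) {M : ℝ} (hM : ∀ t, 0 ≤ t → ‖S.op t‖ ≤ M)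
    (m : ℕ) {t : ℝ} (ht : 0 < t) (x : X) : ‖S.phi m t x‖ ≤ M * ‖x‖ := by
  have h := norm_iterInt_le (g := S.orbit x) (T := t) (C := M * ‖x‖)
    (fun σ hσ => (S.orbit_of_nonneg x hσ.1 ▸ (S.op σ).le_of_opNorm_le (hM σ hσ.1) x)) m
    ⟨ht.le, le_rfl⟩
  rw [S.phi_eq m ht, norm_smul, norm_inv, Real.norm_of_nonneg (pow_nonneg ht.le m),
    inv_mul_le_iff₀ (pow_pos ht m), mul_comm]
  exact h

lemma C0Semigroup.op_integral_orbit [CompleteSpace X] (S : C0Semigroup X) {t τ : ℝ} (ht : 0 ≤ t) (hτ : 0 ≤ τ)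
    (x : X) : S.op t (∫ σ in (0 : ℝ)..τ, S.orbit x σ)
      = (∫ σ in (0 : ℝ)..τ + t, S.orbit x σ) - ∫ σ in (0 : ℝ)..t, S.orbit x σ := by
  have hc := S.continuous_orbit x
  rw [← (S.op t).intervalIntegral_comp_comm (hc.intervalIntegrable 0 τ),
    intervalIntegral.integral_interval_sub_left (hc.intervalIntegrable _ _)
      (hc.intervalIntegrable _ _)]
  have h := intervalIntegral.integral_comp_add_right (a := 0) (b := τ) (S.orbit x) t
  rw [zero_add] at h
  rw [← h]
  refine intervalIntegral.integral_congr fun σ hσ => ?_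
  rw [Set.uIcc_of_le hτ] at hσ
  rw [S.orbit_of_nonneg x hσ.1, S.orbit_of_nonneg x (add_nonneg hσ.1 ht), add_comm,
    S.op_add t σ ht hσ.1]
  rfl

/-- `∫₀^τ S(σ) x dσ` is in the domain of the generator, which maps it to `S(τ) x - x`. -/
lemma C0Semigroup.IsGenerator.integral_orbit [CompleteSpace X] {S : C0Semigroup X} {B : X →ₗ.[ℂ] X}
    (hB : S.IsGenerator B) {τ : ℝ} (hτ : 0 ≤ τ) (x : X) :
    (∫ σ in (0 : ℝ)..τ, S.orbit x σ) ∈ B.domain ∧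
      app B (∫ σ in (0 : ℝ)..τ, S.orbit x σ) = S.op τ x - x := by
  rw [← mem_graph_iff_app, hB]
  have hc := S.continuous_orbit x
  have h1 := (hc.integral_hasStrictDerivAt 0 τ).hasDerivAt.tendsto_slope_zero_right
  have h2 := (hc.integral_hasStrictDerivAt 0 0).hasDerivAt.tendsto_slope_zero_right
  have h3 := h1.sub h2
  rw [S.orbit_of_nonneg x hτ, S.orbit_of_nonneg x le_rfl, S.op_zero] at h3
  refine h3.congr' ?_
  filter_upwards [self_mem_nhdsWithin] with t ht
  rw [S.op_integral_orbit (le_of_lt ht) hτ, ← smul_sub]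
  simp only [zero_add, intervalIntegral.integral_same, sub_zero]
  congr 1
  abel

/-- `J` is the bounded inverse of the restriction of `A` to `ker ∂`. -/
structure IsKerInverse (A : X →ₗ.[ℂ] X) (bd : A.domain →ₗ[ℂ] Y) (J : X →L[ℂ] X) : Prop where
  mem : ∀ x, J x ∈ A.domain
  bdry_eq : ∀ x, bdry bd (J x) = 0
  app_eq : ∀ x, app A (J x) = x
  eq_of_mem : ∀ x ∈ A.domain, bdry bd x = 0 → J (app A x) = x

lemma C0Semigroup.exists_integral_orbit_clm [CompleteSpace X] (S : C0Semigroup X) {M : ℝ}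
    (hM : ∀ t, 0 ≤ t → ‖S.op t‖ ≤ M) {t : ℝ} (ht : 0 ≤ t) :
    ∃ K : X →L[ℂ] X, ∀ x, K x = ∫ σ in (0 : ℝ)..t, S.orbit x σ := by
  have hcont := S.continuous_orbit
  let K₀ : X →ₗ[ℂ] X :=
    { toFun := fun x => ∫ σ in (0 : ℝ)..t, S.orbit x σ
      map_add' := fun x y => by
        rw [← intervalIntegral.integral_add ((hcont x).intervalIntegrable _ _)
          ((hcont y).intervalIntegrable _ _)]
        simp only [C0Semigroup.orbit, map_add]
      map_smul' := fun a x => by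
        rw [RingHom.id_apply, ← intervalIntegral.integral_smul]
        simp only [C0Semigroup.orbit, map_smul] }
  refine ⟨K₀.mkContinuous (M * t) fun x => ?_, fun x => rfl⟩
  have h := norm_iterInt_le (g := S.orbit x) (T := t) (C := M * ‖x‖)
    (fun σ hσ => (S.orbit_of_nonneg x hσ.1 ▸ (S.op σ).le_of_opNorm_le (hM σ hσ.1) x)) 1
    ⟨ht, le_rfl⟩
  calc ‖K₀ x‖ ≤ M * ‖x‖ * t ^ 1 := h
    _ = _ := by ring

lemma C0Semigroup.exists_norm_le_const (S : C0Semigroup X) (hS : S.type < 0) :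
    ∃ M : ℝ, 0 ≤ M ∧ ∀ t : ℝ, 0 ≤ t → ‖S.op t‖ ≤ M := by
  obtain ⟨r, M, hr, hM⟩ := S.exists_norm_le hS
  refine ⟨|M|, abs_nonneg M, fun t ht => (hM t ht).trans ?_⟩
  calc M * Real.exp (r * t) ≤ |M| * 1 := by
        gcongr
        · exact le_abs_self M
        · exact Real.exp_le_one_iff.2 (mul_nonpos_of_nonpos_of_nonneg hr.le ht)
    _ = |M| := mul_one _

/-- For `t` so large that `‖S(t)‖ < 1`, the map `(∫₀ᵗ S(σ) dσ) (S(t) - 1)⁻¹` is a right inverse of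
the generator. -/
lemma C0Semigroup.IsGenerator.exists_right_inverse [CompleteSpace X] {S : C0Semigroup X}
    {B : X →ₗ.[ℂ] X} (hB : S.IsGenerator B) (hS : S.type < 0) :
    ∃ J : X →L[ℂ] X, ∀ x, J x ∈ B.domain ∧ app B (J x) = x := by
  obtain ⟨r, M, hr, hM⟩ := S.exists_norm_le hS
  obtain ⟨M', -, hM'⟩ := S.exists_norm_le_const hS
  have hlim : Tendsto (fun t : ℝ => M * Real.exp (r * t)) atTop (𝓝 0) := by
    have h := Real.tendsto_exp_atBot.comp (tendsto_id.const_mul_atTop_of_neg hr)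
    simpa [Function.comp_def] using h.const_mul M
  obtain ⟨t, ht1, ht0⟩ := ((hlim.eventually (gt_mem_nhds one_pos)).and (eventually_ge_atTop 0)).exists
  -- `S(t) - 1` is invertible by the Neumann series
  have hnorm : ‖S.op t‖ < 1 := (hM t ht0).trans_lt ht1
  obtain ⟨K, hK⟩ := S.exists_integral_orbit_clm hM' ht0
  obtain ⟨U, hU⟩ := isUnit_one_sub_of_norm_lt_one hnorm
  have hUinv : ∀ x, S.op t ((↑U⁻¹ : X →L[ℂ] X) x) - (↑U⁻¹ : X →L[ℂ] X) x = -x := fun x => by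
    have h : (U : X →L[ℂ] X) ((↑U⁻¹ : X →L[ℂ] X) x) = x := by
      rw [← mul_apply_eq_comp, U.mul_inv]; rfl
    rw [hU] at h
    rw [← neg_sub]
    exact congrArg Neg.neg h
  refine ⟨-(K.comp (↑U⁻¹ : X →L[ℂ] X)), fun x => ?_⟩
  have h := hB.integral_orbit ht0 ((↑U⁻¹ : X →L[ℂ] X) x)
  rw [← hK, hUinv] at h
  have h2 := (isLinearOn_app B).smul (-1) _ h.1
  rw [h.2, neg_smul, neg_smul, one_smul, one_smul, neg_neg] at h2
  exact ⟨B.domain.neg_mem h.1, h2⟩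

/-- Uniqueness for the stationary problem with `z = 0` and `v = 0` makes `A₀` injective. -/
lemma IsAbstractIBVP.exists_isKerInverse [CompleteSpace X] {A : X →ₗ.[ℂ] X}
    {bd : A.domain →ₗ[ℂ] Y} {S : C0Semigroup X} (hA : IsAbstractIBVP A bd S) :
    ∃ J : X →L[ℂ] X, IsKerInverse A bd J := by
  obtain ⟨J, hJ⟩ := hA.generator.exists_right_inverse hA.type_neg
  have hmem : ∀ x, J x ∈ A.domain ∧ bdry bd (J x) = 0 := fun x =>
    (mem_kerRestrict_domain bd).1 (hJ x).1
  have happ : ∀ x, app A (J x) = x := fun x => by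
    rw [← app_kerRestrict bd (hJ x).1, (hJ x).2]
  refine ⟨J, fun x => (hmem x).1, fun x => (hmem x).2, happ, fun x hx hx0 => ?_⟩
  have hy : J (app A x) - x ∈ A.domain := A.domain.sub_mem (hmem _).1 hx
  have hAy := (isLinearOn_app A).sub (hmem (app A x)).1 hx
  have hby := (isLinearOn_bdry bd).sub (hmem (app A x)).1 hx
  rw [happ, sub_self, app_of_mem A hy] at hAy
  rw [(hmem _).2, hx0, sub_self, bdry_of_mem bd hy] at hby
  have := (hA.steady_existsUnique 0 (by simpa using hA.type_neg) 0).unique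
    (y₁ := ⟨_, hy⟩) (y₂ := 0) ⟨by simpa using hAy, hby⟩ (by simp)
  exact sub_eq_zero.1 (congrArg Subtype.val this)

namespace IsKerInverse

variable {A : X →ₗ.[ℂ] X} {bd : A.domain →ₗ[ℂ] Y} {J : X →L[ℂ] X} {S : C0Semigroup X}

/-- The `m`-fold antiderivative of `A₀ ∫₀ᵗ S(σ) x dσ = S(t) x - x`, solved for the integral. -/
lemma iterInt_succ [CompleteSpace X] (hJ : IsKerInverse A bd J) (hS : S.IsGenerator (kerRestrict A bd))
    (m : ℕ) {t : ℝ} (ht : 0 ≤ t) (x : X) :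
    iterInt (S.orbit x) (m + 1) t
      = J (iterInt (S.orbit x) m t - (t ^ m / (m.factorial : ℝ)) • x) := by
  induction m generalizing t with
  | zero =>
    obtain ⟨h1, h2⟩ := hS.integral_orbit ht x
    have h3 := (mem_kerRestrict_domain bd).1 h1
    rw [app_kerRestrict bd h1] at h2
    have h4 := hJ.eq_of_mem _ h3.1 h3.2
    rw [h2] at h4
    simpa [iterInt, S.orbit_of_nonneg x ht] using h4.symm
  | succ m ih =>
    have hc := continuous_iterInt (S.continuous_orbit x) m
    have hc' : Continuous fun σ : ℝ => (σ ^ m / (m.factorial : ℝ)) • x := by fun_prop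
    have h1 : iterInt (S.orbit x) (m + 1 + 1) t
        = ∫ σ in (0 : ℝ)..t, J (iterInt (S.orbit x) m σ - (σ ^ m / (m.factorial : ℝ)) • x) := by
      refine intervalIntegral.integral_congr fun σ hσ => ?_
      rw [Set.uIcc_of_le ht] at hσ
      exact ih hσ.1
    have h2 := J.intervalIntegral_comp_comm ((hc.sub hc').intervalIntegrable (μ := MeasureTheory.volume) 0 t)
    simp only [Pi.sub_apply] at h2
    rw [h1, h2, intervalIntegral.integral_sub (hc.intervalIntegrable 0 t) (hc'.intervalIntegrable 0 t),
      intervalIntegral.integral_smul_const, intervalIntegral.integral_div, integral_pow,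
      Nat.factorial_succ]
    congr 3
    push_cast
    have : (m.factorial : ℝ) ≠ 0 := by positivity
    field_simp
    simp

/-- The recurrence `t A₀ φ_{m+1}(t A₀) = φ_m(t A₀) - 1/m!`. -/
lemma smul_phi_succ [CompleteSpace X] (hJ : IsKerInverse A bd J) (hS : S.IsGenerator (kerRestrict A bd))
    (m : ℕ) {t : ℝ} (ht : 0 < t) (x : X) :
    t • S.phi (m + 1) t x = J (S.phi m t x - (1 / (m.factorial : ℝ)) • x) := by
  have ht' : t ^ m ≠ 0 := pow_ne_zero _ ht.ne'
  have h := hJ.iterInt_succ hS m ht.le x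
  rw [← S.pow_smul_phi m ht, ← S.pow_smul_phi (m + 1) ht,
    show (t ^ m / (m.factorial : ℝ)) • x = t ^ m • (1 / (m.factorial : ℝ)) • x by
      rw [smul_smul, mul_one_div], ← smul_sub, ContinuousLinearMap.map_smul_of_tower, pow_succ,
    mul_smul] at h
  exact smul_right_injective X ht' h

lemma eq_pow_of_iterate_app (hJ : IsKerInverse A bd J) {q : ℕ} {x y : X}
    (hd : DomPow (kerRestrict A bd) q x) (h : (app (kerRestrict A bd))^[q] x = y) :
    x = (J ^ q) y := by
  induction q generalizing y with
  | zero => exact h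
  | succ q ih =>
    rw [Function.iterate_succ_apply'] at h
    have h1 := hd q q.lt_succ_self
    have h2 := (mem_kerRestrict_domain bd).1 h1
    rw [app_kerRestrict bd h1] at h
    have h3 := hJ.eq_of_mem _ h2.1 h2.2
    rw [h] at h3
    rw [pow_succ, mul_apply_eq_comp, h3]
    exact ih (domPow_of_le hd q.le_succ) rfl

end IsKerInverse

end Semigroup

/-! ### Bounds in the norm of the smoother space -/

section Smooth

variable {X Y Z : Type*} [NormedAddCommGroup X] [NormedSpace ℂ X]
  [NormedAddCommGroup Y] [NormedSpace ℂ Y]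
  [NormedAddCommGroup Z] [NormedSpace ℂ Z] [CompleteSpace Z]
  {ι : Z →L[ℂ] X}

/-- By the closed graph theorem, a bounded operator which leaves a continuously embedded Banach
space invariant is bounded there. -/
lemma exists_clm_of_maps_into (hι : Function.Injective ι) (L : X →L[ℂ] X)
    (h : ∀ z : Z, ∃ w : Z, ι w = L (ι z)) : ∃ L' : Z →L[ℂ] Z, ∀ z, ι (L' z) = L (ι z) := by
  choose F hF using h
  let F' : Z →ₗ[ℂ] Z :=
    { toFun := F
      map_add' := fun x y => hι (by simp only [hF, map_add])
      map_smul' := fun a x => hι (by simp only [hF, map_smul, RingHom.id_apply]) }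
  have hcont : Continuous F' := by
    refine F'.continuous_of_seq_closed_graph fun v x y hv hFv => hι ?_
    have h1 : Tendsto (fun n => ι (F (v n))) atTop (𝓝 (ι y)) := (ι.continuous.tendsto y).comp hFv
    have h2 : Tendsto (fun n => L (ι (v n))) atTop (𝓝 (L (ι x))) :=
      ((L.continuous.comp ι.continuous).tendsto x).comp hv
    simp only [hF] at h1
    exact (tendsto_nhds_unique h1 h2).trans (hF x).symm
  exact ⟨⟨F', hcont⟩, hF⟩

variable {A : X →ₗ.[ℂ] X} {bd : A.domain →ₗ[ℂ] Y} {J : X →L[ℂ] X} {S : C0Semigroup X}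
  {T : ℝ} {p : ℕ}

/-- `A₀⁻¹` restricts to a bounded operator on the smoother space. -/
lemma IsCompatible.exists_inverse (hZ : IsCompatible (kerRestrict A bd) S ι T p)
    (hι : Function.Injective ι) (hJ : IsKerInverse A bd J) :
    ∃ JZ : Z →L[ℂ] Z, ∀ z, ι (JZ z) = J (ι z) := by
  refine exists_clm_of_maps_into hι J fun z => ?_
  obtain ⟨w, hw, hwz⟩ := hZ.inv_mem z
  refine ⟨w, ?_⟩
  have h := hJ.eq_pow_of_iterate_app (q := 1) (x := ι w) (y := ι z)
    (fun i hi => by obtain rfl := Nat.lt_one_iff.1 hi; exact hw) hwz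
  simpa using h

/-- The operators `A₀^{-(p-1)} e^{t A₀}`, `0 ≤ t ≤ T`, are strongly continuous on the smoother
space, hence uniformly bounded there. -/
lemma IsCompatible.exists_orbit (hZ : IsCompatible (kerRestrict A bd) S ι T p)
    (hι : Function.Injective ι) (hJ : IsKerInverse A bd J) :
    ∃ C : ℝ, 0 ≤ C ∧ ∀ z : Z, ∃ w : ℝ → Z, ContinuousOn w (Set.Icc 0 T) ∧
      ∀ t ∈ Set.Icc 0 T, ι (w t) = (J ^ (p - 1)) (S.op t (ι z)) ∧ ‖w t‖ ≤ C * ‖z‖ := by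
  have horb : ∀ z : Z, ∃ w : ℝ → Z, ContinuousOn w (Set.Icc 0 T) ∧
      ∀ t ∈ Set.Icc 0 T, ι (w t) = (J ^ (p - 1)) (S.op t (ι z)) := fun z => by
    obtain ⟨w, hw, h⟩ := hZ.orbit z
    exact ⟨w, hw, fun t ht => hJ.eq_pow_of_iterate_app (h t ht).1 (h t ht).2⟩
  choose w hw hwt using horb
  have hB : ∀ t : Set.Icc 0 T, ∃ B : Z →L[ℂ] Z, ∀ z, ι (B z) = (J ^ (p - 1)) (S.op t (ι z)) :=
    fun t => exists_clm_of_maps_into hι ((J ^ (p - 1)).comp (S.op t))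
      fun z => ⟨w z t, hwt z t t.2⟩
  choose B hB using hB
  have hBw : ∀ t z, B t z = w z t := fun t z => hι ((hB t z).trans (hwt z t t.2).symm)
  obtain ⟨C, hC⟩ := banach_steinhaus (g := B) fun z => by
    obtain ⟨C, hC⟩ := isCompact_Icc.exists_bound_of_continuousOn (hw z)
    exact ⟨C, fun t => by rw [hBw]; exact hC t t.2⟩
  refine ⟨|C|, abs_nonneg C, fun z => ⟨w z, hw z, fun t ht => ⟨hwt z t ht, ?_⟩⟩⟩
  rw [← hBw ⟨t, ht⟩]
  exact (B ⟨t, ht⟩).le_of_opNorm_le ((hC _).trans (le_abs_self C)) z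

variable [CompleteSpace X]

/-- The recurrence `t A₀ φ_{N+1}(t A₀) = φ_N(t A₀) - 1/N!` trades powers of `t` for powers of
`A₀⁻¹`. -/
lemma IsCompatible.exists_pow_phi_mem (hZ : IsCompatible (kerRestrict A bd) S ι T p)
    (hι : Function.Injective ι) (hJ : IsKerInverse A bd J) (hS : S.IsGenerator (kerRestrict A bd))
    (n m : ℕ) (hm : m ≤ p - 1) :
    ∃ C : ℝ, 0 ≤ C ∧ ∀ t ∈ Set.Ioc 0 T, ∀ z : Z, ∃ w : Z,
      ι w = (J ^ (p - 1 - m)) (t ^ m • S.phi (n + m) t (ι z)) ∧ ‖w‖ ≤ C * ‖z‖ := by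
  induction m with
  | zero =>
    obtain ⟨C, hC0, hC⟩ := hZ.exists_orbit hι hJ
    refine ⟨C, hC0, fun t ht z => ?_⟩
    obtain ⟨w, hw, hwt⟩ := hC z
    have hT : 0 ≤ T := ht.1.le.trans ht.2
    have htI : t ∈ Set.Icc 0 T := ⟨ht.1.le, ht.2⟩
    -- a continuous extension of the orbit to `ℝ`, as required by `iterInt`
    set g : ℝ → Z := Set.IccExtend hT ((Set.Icc 0 T).domRestrict w) with hg
    have hgc : Continuous g := (continuousOn_iff_continuous_domRestrict.1 hw).Icc_extend'
    have hgw : ∀ σ ∈ Set.Icc 0 T, g σ = w σ := fun σ hσ => Set.IccExtend_of_mem hT _ hσ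
    refine ⟨(t ^ n)⁻¹ • iterInt g n t, ?_, ?_⟩
    · have h1 := map_iterInt (ι.restrictScalars ℝ) hgc n t
      have h2 := map_iterInt ((J ^ (p - 1)).restrictScalars ℝ) (S.continuous_orbit (ι z)) n t
      simp only [ContinuousLinearMap.coe_restrictScalars'] at h1 h2
      rw [ContinuousLinearMap.map_smul_of_tower, h1, pow_zero, one_smul, Nat.sub_zero, Nat.add_zero,
        S.phi_eq n ht.1, ContinuousLinearMap.map_smul_of_tower, h2]
      congr 1
      refine iterInt_congr (fun σ hσ => ?_) n htI
      rw [hgw σ hσ, (hwt σ hσ).1, S.orbit_of_nonneg _ hσ.1]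
    · have h := norm_iterInt_le (g := g) (T := T) (C := C * ‖z‖)
        (fun σ hσ => by rw [hgw σ hσ]; exact (hwt σ hσ).2) n htI
      have htn : 0 < t ^ n := pow_pos ht.1 n
      rw [norm_smul, norm_inv, Real.norm_of_nonneg htn.le, inv_mul_le_iff₀ htn, mul_comm]
      exact h
  | succ m ih =>
    obtain ⟨C, hC0, hC⟩ := ih (m.le_succ.trans hm)
    obtain ⟨JZ, hJZ⟩ := hZ.exists_inverse hι hJ
    have hJZpow : ∀ k z, ι ((JZ ^ k) z) = (J ^ k) (ι z) := fun k => by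
      induction k with
      | zero => intro z; rfl
      | succ k ihk =>
        intro z
        rw [pow_succ, pow_succ, mul_apply_eq_comp, mul_apply_eq_comp, ihk, hJZ]
    refine ⟨C + |T| ^ m / ((n + m).factorial : ℝ) * ‖JZ ^ (p - 1 - m)‖, by positivity,
      fun t ht z => ?_⟩
    obtain ⟨w, hw, hwn⟩ := hC t ht z
    refine ⟨w - (t ^ m / ((n + m).factorial : ℝ)) • (JZ ^ (p - 1 - m)) z, ?_, ?_⟩
    · have h1 : p - 1 - m = p - 1 - (m + 1) + 1 := by omega
      rw [map_sub, ContinuousLinearMap.map_smul_of_tower, hw, hJZpow, ← add_assoc, pow_succ, mul_smul,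
        hJ.smul_phi_succ hS (n + m) ht.1, h1, pow_succ, mul_apply_eq_comp, mul_apply_eq_comp]
      simp only [map_sub, ContinuousLinearMap.map_smul_of_tower, smul_sub, smul_smul]
      congr 2
      ring
    · have ht0 := ht.1.le
      have htT : t ≤ |T| := ht.2.trans (le_abs_self T)
      calc ‖w - (t ^ m / ((n + m).factorial : ℝ)) • (JZ ^ (p - 1 - m)) z‖
          ≤ ‖w‖ + ‖(t ^ m / ((n + m).factorial : ℝ)) • (JZ ^ (p - 1 - m)) z‖ := norm_sub_le _ _
        _ ≤ C * ‖z‖ + |T| ^ m / ((n + m).factorial : ℝ) * (‖JZ ^ (p - 1 - m)‖ * ‖z‖) := by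
            rw [norm_smul, Real.norm_of_nonneg (by positivity)]
            gcongr
            exact (JZ ^ (p - 1 - m)).le_opNorm z
        _ = _ := by ring

/-- After `p - 1` applications of the recurrence no power of `A₀⁻¹` is left. -/
lemma IsCompatible.exists_pow_phi_mem_of_le (hZ : IsCompatible (kerRestrict A bd) S ι T p)
    (hι : Function.Injective ι) (hJ : IsKerInverse A bd J) (hS : S.IsGenerator (kerRestrict A bd))
    {N : ℕ} (hN : p - 1 ≤ N) :
    ∃ C : ℝ, 0 ≤ C ∧ ∀ t ∈ Set.Ioc 0 T, ∀ z : Z, ∃ w : Z,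
      ι w = t ^ (p - 1) • S.phi N t (ι z) ∧ ‖w‖ ≤ C * ‖z‖ := by
  have h := hZ.exists_pow_phi_mem hι hJ hS (N - (p - 1)) (p - 1) le_rfl
  simpa only [Nat.sub_add_cancel hN, Nat.sub_self, pow_zero, one_apply_eq_self] using h

end Smooth

/-! ### Stability of finite-dimensional evolutions in an arbitrary norm -/

section Evolution

lemma continuous_seminorm {E : Type*} [NormedAddCommGroup E] [NormedSpace ℝ E]
    [FiniteDimensional ℝ E] (q : Seminorm ℝ E) : Continuous q :=
  q.convexOn.locallyLipschitz.continuous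

/-- The mean value inequality for a seminorm `q` other than the norm of the space. -/
lemma seminorm_sub_le_of_hasDerivWithinAt {E : Type*} [NormedAddCommGroup E] [NormedSpace ℝ E]
    [FiniteDimensional ℝ E] (q : Seminorm ℝ E) {f f' : ℝ → E} {a b c : ℝ} (hab : a ≤ b)
    (hf : ∀ σ ∈ Set.Icc a b, HasDerivWithinAt f (f' σ) (Set.Icc a b) σ)
    (hc : ∀ σ ∈ Set.Icc a b, q (f' σ) ≤ c) : q (f b - f a) ≤ c * (b - a) := by
  have hq := continuous_seminorm q
  have hfc : ContinuousOn f (Set.Icc a b) := fun σ hσ => (hf σ hσ).continuousWithinAt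
  refine image_le_of_liminf_slope_right_le_deriv_boundary (f := fun σ => q (f σ - f a))
    (B := fun σ => c * (σ - a)) (B' := fun _ => c)
    (hq.comp_continuousOn (hfc.sub continuousOn_const)) (by simp) (by fun_prop)
    (fun σ _ => by
      simpa using (((hasDerivAt_id σ).sub_const a).const_mul c).hasDerivWithinAt (s := Set.Ici σ))
    (fun σ hσ r hr => ?_) ⟨hab, le_rfl⟩
  have h1 : HasDerivWithinAt f (f' σ) (Set.Ioi σ) σ :=
    ((hf σ ⟨hσ.1, hσ.2.le⟩).mono_of_mem_nhdsWithin
      (Icc_mem_nhdsGT_of_mem hσ))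
  have h2 : Tendsto (fun z => q (slope f σ z)) (𝓝[>] σ) (𝓝 (q (f' σ))) :=
    (hq.tendsto _).comp ((hasDerivWithinAt_iff_tendsto_slope' (by simp)).1 h1)
  refine Eventually.frequently ?_
  filter_upwards [h2.eventually (gt_mem_nhds ((hc σ ⟨hσ.1, hσ.2.le⟩).trans_lt hr)),
    self_mem_nhdsWithin] with z hz hσz
  refine lt_of_le_of_lt ?_ hz
  have hpos : 0 < z - σ := sub_pos.2 hσz
  rw [slope_def_field, slope_def_module, map_smul_eq_mul, Real.norm_of_nonneg (by positivity),
    div_eq_inv_mul]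
  refine mul_le_mul_of_nonneg_left ?_ (by positivity)
  have h3 := map_add_le_add q (f z - f σ) (f σ - f a)
  rw [sub_add_sub_cancel] at h3
  linarith

variable {E : Type*} [NormedAddCommGroup E] [NormedSpace ℂ E] [FiniteDimensional ℂ E]

lemma hasDerivAt_opExp_smul (B : E →L[ℂ] E) (t : ℝ) :
    HasDerivAt (fun t : ℝ => opExp ((t : ℂ) • B)) (opExp ((t : ℂ) • B) * B) t :=
  haveI : CompleteSpace E := FiniteDimensional.complete ℂ E
  hasDerivAt_exp_smul_const (𝕂 := ℝ) B t

/-- If `e' = B e + G` on `(0, k]` and `e(0) = 0`, then `e(k)` is of the size of `k G`, because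
`d/dσ (exp((k-σ)B) e(σ)) = exp((k-σ)B) G(σ)`. The equation need not hold at the initial time. -/
lemma seminorm_le_of_hasDerivWithinAt (q : Seminorm ℝ E) (B : E →L[ℂ] E) {M c k : ℝ} (hk : 0 < k)
    (hM0 : 0 ≤ M) (hM : ∀ t : ℝ, 0 ≤ t → ∀ x, q (opExp ((t : ℂ) • B) x) ≤ M * q x)
    {e G : ℝ → E} (he0 : e 0 = 0) (he : ContinuousOn e (Set.Icc 0 k))
    (he' : ∀ σ ∈ Set.Ioc 0 k, HasDerivWithinAt e (B (e σ) + G σ) (Set.Icc 0 k) σ)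
    (hG : ∀ σ ∈ Set.Ioc 0 k, q (G σ) ≤ c) : q (e k) ≤ M * c * k := by
  have : FiniteDimensional ℝ E := FiniteDimensional.complexToReal E
  have hexp : ∀ σ, HasDerivAt (fun σ : ℝ => opExp (((k - σ : ℝ) : ℂ) • B))
      (-(opExp (((k - σ : ℝ) : ℂ) • B) * B)) σ := fun σ => by
    have h2 : HasDerivAt (fun σ : ℝ => k - σ) (-1) σ := by
      simpa using (hasDerivAt_id σ).const_sub k
    exact ((hasDerivAt_opExp_smul B (k - σ)).scomp σ h2).congr_deriv (by simp)
  have hR : ∀ σ s, HasDerivWithinAt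
      (fun σ : ℝ => (opExp (((k - σ : ℝ) : ℂ) • B)).restrictScalars ℝ)
      ((-(opExp (((k - σ : ℝ) : ℂ) • B) * B)).restrictScalars ℝ) s σ := fun σ s =>
    (ContinuousLinearMap.restrictScalarsL ℂ E E ℝ ℝ).hasFDerivAt.comp_hasDerivWithinAt σ
      (hexp σ).hasDerivWithinAt
  have hd : ∀ σ ∈ Set.Ioc 0 k, HasDerivWithinAt (fun σ => opExp (((k - σ : ℝ) : ℂ) • B) (e σ))
      (opExp (((k - σ : ℝ) : ℂ) • B) (G σ)) (Set.Icc 0 k) σ := fun σ hσ => by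
    refine ((hR σ _).clm_apply (he' σ hσ)).congr_deriv ?_
    simp
  have hmvt : ∀ a ∈ Set.Ioo 0 k,
      q (e k - opExp (((k - a : ℝ) : ℂ) • B) (e a)) ≤ M * c * (k - a) := fun a ha => by
    have h := seminorm_sub_le_of_hasDerivWithinAt q
      (f := fun σ => opExp (((k - σ : ℝ) : ℂ) • B) (e σ))
      (f' := fun σ => opExp (((k - σ : ℝ) : ℂ) • B) (G σ)) (c := M * c) ha.2.le
      (fun σ hσ => (hd σ ⟨ha.1.trans_le hσ.1, hσ.2⟩).mono (Set.Icc_subset_Icc_left ha.1.le))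
      (fun σ hσ => (hM _ (sub_nonneg.2 hσ.2) _).trans
        (mul_le_mul_of_nonneg_left (hG σ ⟨ha.1.trans_le hσ.1, hσ.2⟩) hM0))
    simpa [opExp] using h
  -- the initial time is reached in the limit `a → 0`
  have hlim : Tendsto (fun a => q (e k - opExp (((k - a : ℝ) : ℂ) • B) (e a))) (𝓝[Set.Ioo 0 k] 0)
      (𝓝 (q (e k - opExp (((k - 0 : ℝ) : ℂ) • B) (e 0)))) := by
    refine ((continuous_seminorm q).tendsto _).comp (tendsto_const_nhds.sub ?_)
    have h1 := (hR 0 (Set.Ioo 0 k)).continuousWithinAt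
    have h2 := (he 0 ⟨le_rfl, hk.le⟩).mono Set.Ioo_subset_Icc_self
    exact h1.clm_apply h2
  have hlim2 : Tendsto (fun a => M * c * (k - a)) (𝓝[Set.Ioo 0 k] 0) (𝓝 (M * c * (k - 0))) :=
    (Continuous.tendsto (by fun_prop) 0).mono_left nhdsWithin_le_nhds
  have : (𝓝[Set.Ioo 0 k] (0 : ℝ)).NeBot := by
    rw [← mem_closure_iff_nhdsWithin_neBot, closure_Ioo hk.ne]
    exact ⟨le_rfl, hk.le⟩
  have := le_of_tendsto_of_tendsto hlim hlim2 (eventually_nhdsWithin_of_forall hmvt)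
  simpa [he0] using this

end Evolution

section Discrete

variable {X Y : Type*} [NormedAddCommGroup X] [NormedSpace ℂ X]
  [NormedAddCommGroup Y] [NormedSpace ℂ Y]

namespace SpaceDisc

variable (D : SpaceDisc X Y)

lemma finite_Xh0 : FiniteDimensional ℂ D.Xh0 :=
  haveI := D.finite_Xh
  Submodule.finiteDimensional_of_le D.Xh0_le

/-- The discrete norm on `X_{h,0}` as a real seminorm. -/
def q : Seminorm ℝ D.Xh0 := (D.nrm.comp (Submodule.inclusion D.Xh0_le)).restrictScalars ℝ

lemma q_apply (x : D.Xh0) : D.q x = D.nrm0 x := rfl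

lemma q_le_of_hasDerivWithinAt {M c k : ℝ} (hk : 0 < k) (hM0 : 0 ≤ M)
    (hM : ∀ t : ℝ, 0 ≤ t → ∀ x, D.q (D.expAh0 t x) ≤ M * D.q x) {e G : ℝ → D.Xh0} (he0 : e 0 = 0)
    (he : ContinuousOn e (Set.Icc 0 k))
    (he' : ∀ σ ∈ Set.Ioc 0 k, HasDerivWithinAt e (D.Ah0 (e σ) + G σ) (Set.Icc 0 k) σ)
    (hG : ∀ σ ∈ Set.Ioc 0 k, D.q (G σ) ≤ c) : D.q (e k) ≤ M * c * k :=
  haveI := D.finite_Xh0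
  seminorm_le_of_hasDerivWithinAt D.q (D.Ah0 : D.Xh0 →L[ℂ] D.Xh0) hk hM0 hM he0 he he' hG

end SpaceDisc

end Discrete

/-! ### Exact solutions of the auxiliary problems -/

section Trajectory

variable {X Y : Type*} [NormedAddCommGroup X] [NormedSpace ℂ X]
  [NormedAddCommGroup Y] [NormedSpace ℂ Y]

/-- The derivative of `vhat`. -/
def vhatDeriv (A : X →ₗ.[ℂ] X) (m j : ℕ) (α : X) (τ : ℝ) : X :=
  ∑ l ∈ Finset.range m, ((l : ℝ) * τ ^ (l - 1) / ((l + j).factorial : ℝ)) • (app A)^[l] α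

lemma hasDerivAt_sum_pow_smul {E : Type*} [NormedAddCommGroup E] [NormedSpace ℝ E] (m j : ℕ)
    (x : ℕ → E) (τ : ℝ) :
    HasDerivAt (fun τ : ℝ => ∑ l ∈ Finset.range m, (τ ^ l / ((l + j).factorial : ℝ)) • x l)
      (∑ l ∈ Finset.range m, ((l : ℝ) * τ ^ (l - 1) / ((l + j).factorial : ℝ)) • x l) τ :=
  HasDerivAt.fun_sum fun l _ => ((hasDerivAt_pow l τ).div_const _).smul_const (x l)

variable {A : X →ₗ.[ℂ] X} {bd : A.domain →ₗ[ℂ] Y} {J : X →L[ℂ] X} {S : C0Semigroup X}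
  {m j N : ℕ} {α : X} {τ : ℝ}

lemma hasDerivAt_vhat (A : X →ₗ.[ℂ] X) (m j : ℕ) (α : X) (τ : ℝ) :
    HasDerivAt (vhat A m j α) (vhatDeriv A m j α τ) τ :=
  hasDerivAt_sum_pow_smul m j (fun l => (app A)^[l] α) τ

lemma vhat_mem (hα : DomPow A m α) : vhat A m j α τ ∈ A.domain :=
  A.domain.sum_mem fun l hl => real_smul_mem _ _ (hα l (Finset.mem_range.1 hl))

lemma vhatDeriv_mem (hα : DomPow A m α) : vhatDeriv A m j α τ ∈ A.domain :=
  A.domain.sum_mem fun l hl => real_smul_mem _ _ (hα l (Finset.mem_range.1 hl))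

lemma vhat_zero (A : X →ₗ.[ℂ] X) (m j : ℕ) (α : X) :
    vhat A (m + 1) j α 0 = (1 / (j.factorial : ℝ)) • α := by
  simp [vhat, Finset.sum_range_succ']

lemma app_vhat (hα : DomPow A m α) : app A (vhat A m j α τ)
    = ∑ l ∈ Finset.range m, (τ ^ l / ((l + j).factorial : ℝ)) • (app A)^[l + 1] α := by
  rw [vhat, (isLinearOn_app A).sum _ _ _ fun l hl => hα l (Finset.mem_range.1 hl)]
  simp only [Function.iterate_succ_apply']

lemma IsLinearOn.hasDerivAt_vhat {E : Type*} [NormedAddCommGroup E] [NormedSpace ℂ E] {G : X → E}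
    (hG : IsLinearOn A.domain G) (hα : DomPow A m α) :
    HasDerivAt (fun τ => G (vhat A m j α τ)) (G (vhatDeriv A m j α τ)) τ := by
  have h1 : (fun τ => G (vhat A m j α τ)) = fun τ : ℝ => ∑ l ∈ Finset.range m,
      (τ ^ l / ((l + j).factorial : ℝ)) • G ((app A)^[l] α) :=
    funext fun τ => hG.sum _ _ _ fun l hl => hα l (Finset.mem_range.1 hl)
  rw [h1, vhatDeriv, hG.sum _ _ _ fun l hl => hα l (Finset.mem_range.1 hl)]
  exact hasDerivAt_sum_pow_smul m j (fun l => G ((app A)^[l] α)) τ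

/-- `τ^j v(τ)`, where `v(τ) = v̂(τ) + τ^m φ_{m+j}(τ A₀) A^m α` solves the auxiliary problem of
index `j` in `X` exactly. The factor `τ^j` removes the singularity at `τ = 0`. -/
def traj (A : X →ₗ.[ℂ] X) (S : C0Semigroup X) (m j : ℕ) (α : X) (τ : ℝ) : X :=
  τ ^ j • vhat A m j α τ + iterInt (S.orbit ((app A)^[m] α)) (m + j) τ

variable [CompleteSpace X]

lemma traj_eq (A : X →ₗ.[ℂ] X) (S : C0Semigroup X) (m j : ℕ) (α : X) (hτ : 0 < τ) :
    traj A S m j α τ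
      = τ ^ j • (vhat A m j α τ + τ ^ m • S.phi (m + j) τ ((app A)^[m] α)) := by
  rw [traj, ← S.pow_smul_phi _ hτ, smul_add, smul_smul, ← pow_add, add_comm j m]

lemma IsKerInverse.iterInt_succ_mem (hJ : IsKerInverse A bd J)
    (hS : S.IsGenerator (kerRestrict A bd)) (N : ℕ) (hτ : 0 ≤ τ) (x : X) :
    iterInt (S.orbit x) (N + 1) τ ∈ A.domain ∧ bdry bd (iterInt (S.orbit x) (N + 1) τ) = 0 ∧
      app A (iterInt (S.orbit x) (N + 1) τ)
        = iterInt (S.orbit x) N τ - (τ ^ N / (N.factorial : ℝ)) • x := by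
  rw [hJ.iterInt_succ hS N hτ]
  exact ⟨hJ.mem _, hJ.bdry_eq _, hJ.app_eq _⟩

lemma traj_mem (hJ : IsKerInverse A bd J) (hS : S.IsGenerator (kerRestrict A bd))
    (hα : DomPow A m α) (hN : m + j = N + 1) (hτ : 0 ≤ τ) : traj A S m j α τ ∈ A.domain := by
  rw [traj, hN]
  exact A.domain.add_mem (real_smul_mem _ _ (vhat_mem hα)) (hJ.iterInt_succ_mem hS N hτ _).1

/-- The correction by the `φ`-function is in `ker ∂`, so only `v̂` contributes to the boundary
values. -/
lemma bdry_traj (hJ : IsKerInverse A bd J) (hS : S.IsGenerator (kerRestrict A bd))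
    (hα : DomPow A m α) (hN : m + j = N + 1) (hτ : 0 ≤ τ) :
    bdry bd (traj A S m j α τ) = τ ^ j • bdry bd (vhat A m j α τ) := by
  obtain ⟨h1, h2, -⟩ := hJ.iterInt_succ_mem hS N hτ ((app A)^[m] α)
  have hv := vhat_mem (j := j) (τ := τ) hα
  rw [traj, hN, (isLinearOn_bdry bd).add _ (real_smul_mem _ _ hv) _ h1,
    (isLinearOn_bdry bd).smul _ _ hv, h2, add_zero]

lemma app_traj (hJ : IsKerInverse A bd J) (hS : S.IsGenerator (kerRestrict A bd))
    (hα : DomPow A m α) (hN : m + j = N + 1) (hτ : 0 ≤ τ) :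
    app A (traj A S m j α τ) = τ ^ j • app A (vhat A m j α τ)
      + (iterInt (S.orbit ((app A)^[m] α)) N τ - (τ ^ N / (N.factorial : ℝ)) • (app A)^[m] α) := by
  obtain ⟨h1, -, h2⟩ := hJ.iterInt_succ_mem hS N hτ ((app A)^[m] α)
  have hv := vhat_mem (j := j) (τ := τ) hα
  rw [traj, hN, (isLinearOn_app A).add _ (real_smul_mem _ _ hv) _ h1,
    (isLinearOn_app A).smul _ _ hv, h2]

lemma hasDerivAt_traj (A : X →ₗ.[ℂ] X) (S : C0Semigroup X) (α : X) (hN : m + j = N + 1) (τ : ℝ) :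
    HasDerivAt (traj A S m j α) (((j : ℝ) * τ ^ (j - 1)) • vhat A m j α τ
      + τ ^ j • vhatDeriv A m j α τ + iterInt (S.orbit ((app A)^[m] α)) N τ) τ := by
  have h1 := (hasDerivAt_pow j τ).smul (hasDerivAt_vhat A m j α τ)
  have h2 := hasDerivAt_iterInt (S.continuous_orbit ((app A)^[m] α)) N τ
  rw [← hN] at h2
  refine (h1.add h2).congr_deriv ?_
  abel

/-- For the index `0` the auxiliary problem in `X` is `v' = A v`. -/
lemma hasDerivAt_traj_zero (hJ : IsKerInverse A bd J) (hS : S.IsGenerator (kerRestrict A bd))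
    (hα : DomPow A (m + 1) α) (hτ : 0 ≤ τ) :
    HasDerivAt (traj A S (m + 1) 0 α) (app A (traj A S (m + 1) 0 α τ)) τ := by
  refine (hasDerivAt_traj A S α (add_zero (m + 1)) τ).congr_deriv ?_
  have h : ∀ l : ℕ, ((l + 1 : ℕ) : ℝ) * τ ^ (l + 1 - 1) / ((l + 1 + 0).factorial : ℝ)
      = τ ^ l / ((l + 0).factorial : ℝ) := fun l => by
    have h1 : (l.factorial : ℝ) ≠ 0 := by positivity
    rw [add_zero, add_zero, Nat.factorial_succ, Nat.add_sub_cancel]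
    push_cast
    field_simp
  have h1 : vhatDeriv A (m + 1) 0 α τ
      = ∑ l ∈ Finset.range m, (τ ^ l / ((l + 0).factorial : ℝ)) • (app A)^[l + 1] α := by
    rw [vhatDeriv, Finset.sum_range_succ']
    simp only [h]
    simp
  rw [h1, app_traj hJ hS hα (add_zero (m + 1)) hτ, app_vhat hα, Finset.sum_range_succ]
  simp

/-- For the index `j + 1` the auxiliary problem in `X` is
`v' = (A - (j + 1)/τ) v + α / (j! τ)`; multiplication by `τ^(j+1)` removes the singular terms. -/
lemma hasDerivAt_traj_succ (hJ : IsKerInverse A bd J) (hS : S.IsGenerator (kerRestrict A bd))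
    (hα : DomPow A m α) (hτ : 0 ≤ τ) :
    HasDerivAt (traj A S m (j + 1) α)
      (app A (traj A S m (j + 1) α τ) + (τ ^ j / (j.factorial : ℝ)) • α) τ := by
  -- the sum of the derivatives of `τ^(l+j+1) / (l+j+1)!`, with the index shifted by one
  have key : ∀ (x : ℕ → X) (m : ℕ),
      (((j + 1 : ℕ) : ℝ) * τ ^ j) • ∑ l ∈ Finset.range m, (τ ^ l / ((l + (j + 1)).factorial : ℝ)) • x l
        + τ ^ (j + 1) • ∑ l ∈ Finset.range m,
            ((l : ℝ) * τ ^ (l - 1) / ((l + (j + 1)).factorial : ℝ)) • x l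
      = τ ^ (j + 1) • ∑ l ∈ Finset.range m, (τ ^ l / ((l + (j + 1)).factorial : ℝ)) • x (l + 1)
        - (τ ^ (m + j) / ((m + j).factorial : ℝ)) • x m + (τ ^ j / (j.factorial : ℝ)) • x 0 := by
    intro x m
    induction m with
    | zero => simp
    | succ m ih =>
      rw [Finset.sum_range_succ, Finset.sum_range_succ, Finset.sum_range_succ, smul_add, smul_add,
        smul_add, add_add_add_comm, ih]
      have h1 : (((j + 1 : ℕ) : ℝ) * τ ^ j) * (τ ^ m / ((m + (j + 1)).factorial : ℝ))
          + τ ^ (j + 1) * ((m : ℝ) * τ ^ (m - 1) / ((m + (j + 1)).factorial : ℝ))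
          = τ ^ (m + j) / ((m + j).factorial : ℝ) := by
        have h2 : (m : ℝ) * τ ^ (m - 1) * τ = m * τ ^ m := by
          cases m with
          | zero => simp
          | succ m => rw [Nat.add_sub_cancel]; ring
        have h3 : (((m + j).factorial : ℕ) : ℝ) ≠ 0 := by positivity
        rw [← add_assoc m j 1, Nat.factorial_succ]
        push_cast
        rw [show τ ^ (j + 1) * ((m : ℝ) * τ ^ (m - 1) / (((m : ℝ) + j + 1) * (m + j).factorial))
          = τ ^ j * (m * τ ^ (m - 1) * τ) / (((m : ℝ) + j + 1) * (m + j).factorial) by ring, h2]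
        field_simp
        ring
      have h4 : τ ^ (j + 1) * (τ ^ m / ((m + (j + 1)).factorial : ℝ))
          = τ ^ (m + 1 + j) / ((m + 1 + j).factorial : ℝ) := by
        rw [show m + (j + 1) = m + 1 + j by ring]; ring
      simp only [smul_smul]
      rw [← add_smul, h1, h4]
      abel
  refine (hasDerivAt_traj A S α (add_assoc m j 1).symm τ).congr_deriv ?_
  have h := key (fun l => (app A)^[l] α) m
  rw [app_traj hJ hS hα (add_assoc m j 1).symm hτ, app_vhat hα, vhat, vhatDeriv,
    Nat.add_sub_cancel, h]
  simp only [Function.iterate_zero, id]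
  abel

end Trajectory

/-! ### The error of the discretized auxiliary problems -/

section DiscreteError

variable {X Y Z : Type*} [NormedAddCommGroup X] [NormedSpace ℂ X]
  [NormedAddCommGroup Y] [NormedSpace ℂ Y] [NormedAddCommGroup Z] [NormedSpace ℂ Z]
  {A : X →ₗ.[ℂ] X} {bd : A.domain →ₗ[ℂ] Y} {ι : Z →L[ℂ] X}

namespace SpaceDisc

variable (D : SpaceDisc X Y)

lemma isLinearOn_LQ (bd : A.domain →ₗ[ℂ] Y) :
    IsLinearOn A.domain fun x => D.LQ (bdry bd x) :=
  (isLinearOn_bdry bd).comp ((D.Lh : X →ₗ[ℂ] D.Xh0) ∘ₗ D.Xh.subtype ∘ₗ D.Qh)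

lemma isLinearOn_AQ (bd : A.domain →ₗ[ℂ] Y) :
    IsLinearOn A.domain fun x => D.AQ (bdry bd x) :=
  (isLinearOn_bdry bd).comp (D.Ah ∘ₗ D.Qh)

lemma isLinearOn_Ph (bd : A.domain →ₗ[ℂ] Y) : IsLinearOn A.domain (D.Ph bd) :=
  (isLinearOn_linearMap A.domain (D.Lh : X →ₗ[ℂ] D.Xh0)).sub_fun (D.isLinearOn_LQ bd)

lemma isLinearOn_Rh (bd : A.domain →ₗ[ℂ] Y) : IsLinearOn A.domain (D.Rh bd) :=
  (((isLinearOn_app A).comp (D.Lh : X →ₗ[ℂ] D.Xh0)).sub_fun (D.isLinearOn_AQ bd)).comp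
    (D.Ah0.symm : D.Xh0 →ₗ[ℂ] D.Xh0)

lemma Ah0_Rh (bd : A.domain →ₗ[ℂ] Y) (x : X) :
    D.Ah0 (D.Rh bd x) = D.Lh (app A x) - D.AQ (bdry bd x) :=
  D.Ah0.apply_symm_apply _

lemma LQ_bdry_traj [CompleteSpace X] {J : X →L[ℂ] X} {S : C0Semigroup X} (hJ : IsKerInverse A bd J)
    (hS : S.IsGenerator (kerRestrict A bd)) {m j : ℕ} {α : X} (hα : DomPow A m α) {τ : ℝ}
    (hτ : 0 ≤ τ) : D.LQ (bdry bd (traj A S m (j + 1) α τ))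
      = τ ^ (j + 1) • D.LQ (bdry bd (vhat A m (j + 1) α τ)) := by
  have hvh := vhat_mem (j := j + 1) (τ := τ) hα
  rw [bdry_traj hJ hS hα (add_assoc m j 1).symm hτ, ← (D.isLinearOn_LQ bd).smul _ _ hvh,
    (isLinearOn_bdry bd).smul _ _ hvh]

lemma AQ_bdry_traj [CompleteSpace X] {J : X →L[ℂ] X} {S : C0Semigroup X} (hJ : IsKerInverse A bd J)
    (hS : S.IsGenerator (kerRestrict A bd)) {m j : ℕ} {α : X} (hα : DomPow A m α) {τ : ℝ}
    (hτ : 0 ≤ τ) : D.AQ (bdry bd (traj A S m (j + 1) α τ))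
      = τ ^ (j + 1) • D.AQ (bdry bd (vhat A m (j + 1) α τ)) := by
  have hvh := vhat_mem (j := j + 1) (τ := τ) hα
  rw [bdry_traj hJ hS hα (add_assoc m j 1).symm hτ, ← (D.isLinearOn_AQ bd).smul _ _ hvh,
    (isLinearOn_bdry bd).smul _ _ hvh]

/-- The stability and consistency bounds of one space discretization. -/
structure Bounds (bd : A.domain →ₗ[ℂ] Y) (ι : Z →L[ℂ] X) (M ε : ℝ) : Prop where
  M_nonneg : 0 ≤ M
  eps_nonneg : 0 ≤ ε
  exp_le : ∀ t : ℝ, 0 ≤ t → ∀ x, D.q (D.expAh0 t x) ≤ M * D.q x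
  inv_le : ∀ x, D.q (D.Ah0.symm x) ≤ M * D.q x
  Lh_le : ∀ x, D.q (D.Lh x) ≤ M * ‖x‖
  LQ_le : ∀ v, D.q (D.LQ v) ≤ M * ‖v‖
  consistency : ∀ z : Z, ι z ∈ A.domain →
    D.q (D.Ah0 (D.Rh bd (ι z) - D.Ph bd (ι z))) ≤ ε * ‖z‖

variable {D} {M ε K k : ℝ}

namespace Bounds

lemma consistency' (hD : D.Bounds bd ι M ε) {z : Z} (hz : ι z ∈ A.domain) :
    D.q (D.Ah0 (D.Ph bd (ι z) - D.Rh bd (ι z))) ≤ ε * ‖z‖ := by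
  rw [← neg_sub, map_neg, map_neg_eq_map]
  exact hD.consistency z hz

lemma q_Rh_sub_Ph_le (hD : D.Bounds bd ι M ε) {z : Z} (hz : ι z ∈ A.domain) :
    D.q (D.Rh bd (ι z) - D.Ph bd (ι z)) ≤ M * (ε * ‖z‖) := by
  have h := hD.inv_le (D.Ah0 (D.Rh bd (ι z) - D.Ph bd (ι z)))
  rw [ContinuousLinearEquiv.symm_apply_apply] at h
  exact h.trans (mul_le_mul_of_nonneg_left (hD.consistency z hz) hD.M_nonneg)

lemma q_Ph_sub_Rh_le (hD : D.Bounds bd ι M ε) {z : Z} (hz : ι z ∈ A.domain) :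
    D.q (D.Ph bd (ι z) - D.Rh bd (ι z)) ≤ M * (ε * ‖z‖) := by
  rw [← neg_sub, map_neg_eq_map]
  exact hD.q_Rh_sub_Ph_le hz

variable {J : X →L[ℂ] X} {S : C0Semigroup X} [CompleteSpace X]

/-- The quantity `V - P_h v - (R_h - P_h) α` starts from `0` and satisfies the homogeneous evolution
equation up to terms `A_{h,0} (R_h - P_h)`. -/
lemma vbar0_error (hD : D.Bounds bd ι M ε) (hJ : IsKerInverse A bd J)
    (hS : S.IsGenerator (kerRestrict A bd)) {m : ℕ} {α : X} (hα : DomPow A (m + 1) α)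
    {V : ℝ → D.Xh0} (hk : 0 < k) (hV : IsVbar0 D bd m α k V) {a : Z} (ha : ι a = α)
    (haK : ‖a‖ ≤ K)
    (hW : ∀ τ ∈ Set.Ioc 0 k, ∃ w : Z, ι w = traj A S (m + 1) 0 α τ ∧ ‖w‖ ≤ K)
    (hWk : ∃ w : Z, ι w = traj A S (m + 1) 0 α k - α ∧ ‖w‖ ≤ K * k) :
    D.q (V k - D.Rh bd (traj A S (m + 1) 0 α k)) ≤ (3 * M * K) * (k * ε) := by
  have hM0 := hD.M_nonneg
  have hε0 := hD.eps_nonneg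
  have hαd : α ∈ A.domain := hα 0 m.succ_pos
  set W := traj A S (m + 1) 0 α with hWdef
  set r₀ := D.Rh bd α - D.Ph bd α with hr₀
  have hWd : ∀ τ, 0 ≤ τ → W τ ∈ A.domain := fun τ hτ => traj_mem hJ hS hα (add_zero (m + 1)) hτ
  have hWb : ∀ τ, 0 ≤ τ → bdry bd (W τ) = bdry bd (vhat A (m + 1) 0 α τ) := fun τ hτ => by
    rw [hWdef, bdry_traj hJ hS hα (add_zero (m + 1)) hτ, pow_zero, one_smul]
  set e : ℝ → D.Xh0 := fun τ =>
    V τ - (D.Lh (W τ) - D.LQ (bdry bd (vhat A (m + 1) 0 α τ))) - r₀ with he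
  have hder : ∀ τ ∈ Set.Icc 0 k, HasDerivWithinAt e
      (D.Ah0 (e τ) + (D.Ah0 (D.Ph bd (W τ) - D.Rh bd (W τ)) + D.Ah0 r₀)) (Set.Icc 0 k) τ := by
    intro τ hτ
    have h1 := (D.Lh.restrictScalars ℝ).hasFDerivAt.comp_hasDerivAt τ
      (hasDerivAt_traj_zero hJ hS hα hτ.1)
    have h2 := (D.isLinearOn_LQ bd).hasDerivAt_vhat (j := 0) (τ := τ) hα
    have h3 := ((hV.hasDeriv τ hτ).sub (h1.sub h2).hasDerivWithinAt).sub_const r₀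
    refine h3.congr_deriv ?_
    rw [(hasDerivAt_vhat A (m + 1) 0 α τ).deriv, he, Ph, hWb τ hτ.1]
    simp only [map_sub, Ah0_Rh, hWb τ hτ.1, ContinuousLinearMap.coe_restrictScalars']
    abel
  have he0 : e 0 = 0 := by
    have hW0 : W 0 = α := by simp [hWdef, traj, iterInt, vhat_zero]
    simp only [he, hV.initial, hW0, vhat_zero, hr₀, Ph]
    simp
  have hG : ∀ τ ∈ Set.Ioc 0 k,
      D.q (D.Ah0 (D.Ph bd (W τ) - D.Rh bd (W τ)) + D.Ah0 r₀) ≤ 2 * (ε * K) := by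
    intro τ hτ
    obtain ⟨w, hw, hwK⟩ := hW τ hτ
    have h1 := hD.consistency' (z := w) (hw ▸ hWd τ hτ.1.le)
    have h2 := hD.consistency a (ha ▸ hαd)
    rw [hw] at h1
    rw [ha] at h2
    calc _ ≤ _ := map_add_le_add D.q _ _
      _ ≤ ε * ‖w‖ + ε * ‖a‖ := add_le_add h1 h2
      _ ≤ ε * K + ε * K := by gcongr
      _ = _ := by ring
  have hek := D.q_le_of_hasDerivWithinAt hk hM0 hD.exp_le he0
    (fun τ hτ => (hder τ hτ).continuousWithinAt) (fun τ hτ => hder τ ⟨hτ.1.le, hτ.2⟩) hG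
  obtain ⟨w, hw, hwK⟩ := hWk
  have hwd : W k - α ∈ A.domain := A.domain.sub_mem (hWd k hk.le) hαd
  have h1 := hD.q_Ph_sub_Rh_le (z := w) (hw ▸ hwd)
  rw [hw, (D.isLinearOn_Ph bd).sub (hWd k hk.le) hαd,
    (D.isLinearOn_Rh bd).sub (hWd k hk.le) hαd] at h1
  have hsplit : V k - D.Rh bd (W k)
      = e k + (D.Ph bd (W k) - D.Ph bd α - (D.Rh bd (W k) - D.Rh bd α)) := by
    simp only [he, hr₀, Ph, hWb k hk.le]
    abel
  rw [hsplit]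
  calc _ ≤ _ := map_add_le_add D.q _ _
    _ ≤ M * (2 * (ε * K)) * k + M * (ε * (K * k)) := by
        refine add_le_add hek (h1.trans ?_)
        gcongr
    _ = _ := by ring

/-- The equation of `τ^j (V - P_h v)`: the terms with `1/τ` cancel, and only terms with `R_h - P_h`
are left besides the homogeneous evolution equation. -/
lemma vbar_hasDerivWithinAt (hJ : IsKerInverse A bd J)
    (hS : S.IsGenerator (kerRestrict A bd)) {m j : ℕ} {α : X} (hα : DomPow A m α)
    (hαd : α ∈ A.domain) {V : ℝ → D.Xh0} (hV : IsVbar D bd m (j + 1) α k V) {τ : ℝ}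
    (hτ : τ ∈ Set.Ioc 0 k) :
    HasDerivWithinAt (fun τ => τ ^ (j + 1) • V τ - D.Ph bd (traj A S m (j + 1) α τ))
      (D.Ah0 (τ ^ (j + 1) • V τ - D.Ph bd (traj A S m (j + 1) α τ))
        + (D.Ah0 (D.Ph bd (traj A S m (j + 1) α τ) - D.Rh bd (traj A S m (j + 1) α τ))
          + (τ ^ j / (j.factorial : ℝ)) • (D.Rh bd α - D.Ph bd α))) (Set.Icc 0 k) τ := by
  have hτ0 : τ ≠ 0 := hτ.1.ne'
  have hvh := vhat_mem (j := j + 1) (τ := τ) hα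
  have hvh' := vhatDeriv_mem (j := j + 1) (τ := τ) hα
  have hP : ∀ σ ∈ Set.Icc 0 k, D.Ph bd (traj A S m (j + 1) α σ) = D.Lh (traj A S m (j + 1) α σ)
      - σ ^ (j + 1) • D.LQ (bdry bd (vhat A m (j + 1) α σ)) := fun σ hσ => by
    rw [Ph, D.LQ_bdry_traj hJ hS hα hσ.1]
  have h1 := (D.Lh.restrictScalars ℝ).hasFDerivAt.comp_hasDerivAt τ
    (hasDerivAt_traj_succ (j := j) hJ hS hα hτ.1.le)
  have h2 := (hasDerivAt_pow (j + 1) τ).smul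
    ((D.isLinearOn_LQ bd).hasDerivAt_vhat (j := j + 1) (τ := τ) hα)
  have h3 := ((hasDerivAt_pow (j + 1) τ).hasDerivWithinAt.smul (hV.hasDeriv τ hτ)).sub
    (h1.sub h2).hasDerivWithinAt
  refine (h3.congr_of_mem (fun σ hσ => ?_) ⟨hτ.1.le, hτ.2⟩).congr_deriv ?_
  · rw [hP σ hσ]; rfl
  have h4 := (D.isLinearOn_LQ bd).sub
    (A.domain.sub_mem (real_smul_mem _ (1 / ((j.factorial : ℝ) * τ)) hαd)
      (real_smul_mem _ (((j + 1 : ℕ) : ℝ) / τ) hvh)) hvh'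
  rw [(D.isLinearOn_LQ bd).sub (real_smul_mem _ (1 / ((j.factorial : ℝ) * τ)) hαd)
      (real_smul_mem _ (((j + 1 : ℕ) : ℝ) / τ) hvh), (D.isLinearOn_LQ bd).smul _ _ hαd,
      (D.isLinearOn_LQ bd).smul _ _ hvh] at h4
  have h5 : ∀ (r : ℝ) (x : D.Xh0), D.Ah0 (r • x) = r • D.Ah0 x := fun r x =>
    (D.Ah0 : D.Xh0 →ₗ[ℂ] D.Xh0).map_smul_of_tower r x
  have h6 : ∀ (r : ℝ) (x : X), D.Lh (r • x) = r • D.Lh x := fun r x =>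
    (D.Lh : X →ₗ[ℂ] D.Xh0).map_smul_of_tower r x
  rw [(hasDerivAt_vhat A m (j + 1) α τ).deriv, Nat.add_sub_cancel, h4]
  simp only [map_sub, map_add, Ah0_Rh, D.AQ_bdry_traj hJ hS hα hτ.1.le, h5, h6,
    ContinuousLinearMap.coe_restrictScalars', Ph]
  have h7 : (j.factorial : ℝ) ≠ 0 := by positivity
  match_scalars <;> (try field_simp) <;> ring

/-- The quantity `τ^j (V - P_h v)` starts from `0` and satisfies a regular evolution equation. -/
lemma vbar_error (hD : D.Bounds bd ι M ε) (hJ : IsKerInverse A bd J)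
    (hS : S.IsGenerator (kerRestrict A bd)) {m j : ℕ} {α : X} (hα : DomPow A m α)
    (hαd : α ∈ A.domain)
    {V : ℝ → D.Xh0} {T : ℝ} (hk : 0 < k) (hkT : k ≤ T) (hV : IsVbar D bd m (j + 1) α k V)
    {a : Z} (ha : ι a = α) (haK : ‖a‖ ≤ K) {v : ℝ → X}
    (hv : ∀ τ ∈ Set.Ioc 0 k, traj A S m (j + 1) α τ = τ ^ (j + 1) • v τ)
    (hvd : ∀ τ ∈ Set.Ioc 0 k, v τ ∈ A.domain)
    (hvZ : ∀ τ ∈ Set.Ioc 0 k, ∃ w : Z, ι w = v τ ∧ ‖w‖ ≤ K) :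
    D.q (V k - D.Rh bd (v k)) ≤ (M * (T + M + 1) * K) * ε := by
  have hM0 := hD.M_nonneg
  have hε0 := hD.eps_nonneg
  have hK0 : 0 ≤ K := (norm_nonneg a).trans haK
  have hder := fun τ hτ => vbar_hasDerivWithinAt (τ := τ) hJ hS hα hαd hV hτ
  set W := traj A S m (j + 1) α with hWdef
  set r₀ := D.Rh bd α - D.Ph bd α with hr₀
  have hec : ContinuousOn (fun τ => τ ^ (j + 1) • V τ - D.Ph bd (W τ)) (Set.Icc 0 k) := by
    refine ((continuous_pow (j + 1)).continuousOn.smul hV.continuousOn).sub ?_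
    have h1 : ContinuousOn (fun τ => D.Lh (W τ)
        - τ ^ (j + 1) • D.LQ (bdry bd (vhat A m (j + 1) α τ))) (Set.Icc 0 k) := fun τ _ =>
      ((D.Lh.continuous.continuousAt.comp
        (hasDerivAt_traj A S α (add_assoc m j 1).symm τ).continuousAt).sub
        ((continuous_pow (j + 1)).continuousAt.smul
          ((D.isLinearOn_LQ bd).hasDerivAt_vhat (j := j + 1) hα).continuousAt)).continuousWithinAt
    refine h1.congr fun τ hτ => ?_
    rw [Ph, D.LQ_bdry_traj hJ hS hα hτ.1]
  have he0 : (0 : ℝ) ^ (j + 1) • V 0 - D.Ph bd (W 0) = 0 := by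
    have hW0 : W 0 = 0 := by simp [hWdef, traj, iterInt]
    rw [hW0, (D.isLinearOn_Ph bd).zero]
    simp
  have hG : ∀ τ ∈ Set.Ioc 0 k, D.q (D.Ah0 (D.Ph bd (W τ) - D.Rh bd (W τ))
      + (τ ^ j / (j.factorial : ℝ)) • r₀) ≤ k ^ j * ((T + M) * (ε * K)) := by
    intro τ hτ
    have hτ0 := hτ.1.le
    obtain ⟨w, hw, hwK⟩ := hvZ τ hτ
    have h1 := hD.consistency' (z := τ ^ (j + 1) • w) (by
      rw [ContinuousLinearMap.map_smul_of_tower, hw]; exact real_smul_mem _ _ (hvd τ hτ))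
    have h2 := hD.q_Rh_sub_Ph_le (z := a) (ha ▸ hαd)
    rw [ContinuousLinearMap.map_smul_of_tower, hw, ← hv τ hτ, norm_smul,
      Real.norm_of_nonneg (by positivity)] at h1
    rw [ha] at h2
    have h3 : τ ^ j / (j.factorial : ℝ) ≤ k ^ j := by
      refine (div_le_self (by positivity) ?_).trans (pow_le_pow_left₀ hτ0 hτ.2 j)
      exact_mod_cast Nat.one_le_iff_ne_zero.2 j.factorial_ne_zero
    have h4 : τ ^ (j + 1) ≤ k ^ j * T := by
      rw [pow_succ]
      exact mul_le_mul (pow_le_pow_left₀ hτ0 hτ.2 j) (hτ.2.trans hkT) hτ0 (by positivity)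
    have hT0 : 0 ≤ T := hk.le.trans hkT
    calc _ ≤ _ := map_add_le_add D.q _ _
      _ ≤ ε * (τ ^ (j + 1) * ‖w‖) + τ ^ j / (j.factorial : ℝ) * (M * (ε * ‖a‖)) := by
          refine add_le_add h1 ?_
          rw [map_smul_eq_mul, Real.norm_of_nonneg (by positivity)]
          gcongr
      _ ≤ ε * ((k ^ j * T) * K) + k ^ j * (M * (ε * K)) := by gcongr
      _ = _ := by ring
  have hek := D.q_le_of_hasDerivWithinAt hk hM0 hD.exp_le he0 hec hder hG
  have hkI : k ∈ Set.Ioc 0 k := ⟨hk, le_rfl⟩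
  have hek' : k ^ (j + 1) • V k - D.Ph bd (W k) = k ^ (j + 1) • (V k - D.Ph bd (v k)) := by
    rw [smul_sub, ← (D.isLinearOn_Ph bd).smul (k ^ (j + 1)) _ (hvd k hkI), ← hv k hkI]
  have hkpos : 0 < k ^ (j + 1) := by positivity
  rw [hek', map_smul_eq_mul, Real.norm_of_nonneg hkpos.le] at hek
  have h1 : D.q (V k - D.Ph bd (v k)) ≤ M * ((T + M) * (ε * K)) := by
    refine le_of_mul_le_mul_left (hek.trans_eq ?_) hkpos
    ring
  obtain ⟨w, hw, hwK⟩ := hvZ k hkI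
  have h2 := hD.q_Ph_sub_Rh_le (z := w) (hw ▸ hvd k hkI)
  rw [hw] at h2
  rw [← sub_add_sub_cancel _ (D.Ph bd (v k))]
  calc _ ≤ _ := map_add_le_add D.q _ _
    _ ≤ M * ((T + M) * (ε * K)) + M * (ε * K) := by
        refine add_le_add h1 (h2.trans ?_)
        gcongr
    _ = _ := by ring

end Bounds

end SpaceDisc

lemma IsSpaceDisc.exists_bounds {D : ℕ → SpaceDisc X Y} {h ε : ℕ → ℝ}
    (hD : IsSpaceDisc bd ι D h ε) : ∃ M : ℝ, ∀ i, (D i).Bounds bd ι M (ε i) := by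
  obtain ⟨M₁, h₁⟩ := hD.exp_bdd
  obtain ⟨M₂, h₂⟩ := hD.inv_bdd
  obtain ⟨M₃, h₃⟩ := hD.Lh_bdd
  obtain ⟨M₄, h₄⟩ := hD.LQ_bdd
  have key : ∀ {a x y : ℝ}, 0 ≤ x → y ≤ a * x →
      a ≤ |M₁| + |M₂| + |M₃| + |M₄| → y ≤ (|M₁| + |M₂| + |M₃| + |M₄|) * x :=
    fun hx hy ha => hy.trans (mul_le_mul_of_nonneg_right ha hx)
  have a₁ := le_abs_self M₁
  have a₂ := le_abs_self M₂
  have a₃ := le_abs_self M₃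
  have a₄ := le_abs_self M₄
  have b₁ := abs_nonneg M₁
  have b₂ := abs_nonneg M₂
  have b₃ := abs_nonneg M₃
  have b₄ := abs_nonneg M₄
  exact ⟨|M₁| + |M₂| + |M₃| + |M₄|, fun i =>
    { M_nonneg := by positivity
      eps_nonneg := hD.eps_nonneg i
      exp_le := fun t ht x => key (apply_nonneg (D i).q x) (h₁ i t ht x) (by linarith)
      inv_le := fun x => key (apply_nonneg (D i).q x) (h₂ i x) (by linarith)
      Lh_le := fun x => key (norm_nonneg x) (h₃ i x) (by linarith)
      LQ_le := fun x => key (norm_nonneg x) (h₄ i x) (by linarith)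
      consistency := hD.consistency i }⟩

end DiscreteError

/-! ### The local error of the full discretization -/

section LocalError

variable {X Y Z : Type*} [NormedAddCommGroup X] [NormedSpace ℂ X]
  [NormedAddCommGroup Y] [NormedSpace ℂ Y] [NormedAddCommGroup Z] [NormedSpace ℂ Z]
  {A : X →ₗ.[ℂ] X} {bd : A.domain →ₗ[ℂ] Y} {ι : Z →L[ℂ] X}
  {J : X →L[ℂ] X} {S : C0Semigroup X} {T : ℝ} {p : ℕ}

lemma ZRegular.exists_bound {m : ℕ} {u : ℝ → X} (hu : ZRegular A ι T m u) :
    ∃ K : ℝ, 0 ≤ K ∧ ∀ t ∈ Set.Icc 0 T, DomPow A m (u t) ∧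
      ∃ a : ℕ → Z, ∀ l ≤ m, ι (a l) = (app A)^[l] (u t) ∧ ‖a l‖ ≤ K := by
  choose! w hw hwt using hu
  have hC : ∀ l ≤ m, ∃ C, ∀ t ∈ Set.Icc 0 T, ‖w l t‖ ≤ C := fun l hl =>
    isCompact_Icc.exists_bound_of_continuousOn (hw l hl)
  choose! C hC using hC
  refine ⟨∑ l ∈ Finset.range (m + 1), |C l|, Finset.sum_nonneg fun l _ => abs_nonneg _,
    fun t ht => ⟨(hwt m le_rfl t ht).1, fun l => w l t, fun l hl => ⟨(hwt l hl t ht).2, ?_⟩⟩⟩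
  exact ((hC l hl t ht).trans (le_abs_self _)).trans
    (Finset.single_le_sum (f := fun l => |C l|) (fun l _ => abs_nonneg _)
      (Finset.mem_range.2 (Nat.lt_succ_of_le hl)))

/-- The increments of the solution are those of `∫ (A u + f)`, an integral in the smoother space. -/
lemma IsSolution.exists_increment [CompleteSpace X] [CompleteSpace Z] {f u : ℝ → X} {g : ℝ → Y}
    {u₀ : X} (hu : IsSolution A bd T f g u₀ u) {m n : ℕ} (huZ : ZRegular A ι T (m + 1) u)
    (hfZ : ZRegular A ι T n f) :
    ∃ C : ℝ, 0 ≤ C ∧ ∀ s ∈ Set.Icc 0 T, ∀ t ∈ Set.Icc 0 T, s ≤ t →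
      ∃ w : Z, ι w = u t - u s ∧ ‖w‖ ≤ C * (t - s) := by
  obtain ⟨w₁, hw₁, h₁⟩ := huZ 1 (Nat.le_add_left 1 m)
  obtain ⟨w₂, hw₂, h₂⟩ := hfZ 0 n.zero_le
  have hw := hw₁.add hw₂
  obtain ⟨C, hC⟩ := isCompact_Icc.exists_bound_of_continuousOn hw
  refine ⟨|C|, abs_nonneg C, fun s hs t ht hst => ⟨∫ σ in s..t, (w₁ + w₂) σ, ?_, ?_⟩⟩
  · have hsub : Set.Icc s t ⊆ Set.Icc 0 T := Set.Icc_subset_Icc hs.1 ht.2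
    have hint : IntervalIntegrable (w₁ + w₂) MeasureTheory.volume s t :=
      (hw.mono (by rwa [Set.uIcc_of_le hst])).intervalIntegrable
    rw [← ι.intervalIntegral_comp_comm hint]
    have hint' : IntervalIntegrable (fun σ => ι ((w₁ + w₂) σ)) MeasureTheory.volume s t :=
      ((ι.continuous.comp_continuousOn hw).mono (by rwa [Set.uIcc_of_le hst])).intervalIntegrable
    refine intervalIntegral.integral_eq_sub_of_hasDerivAt_of_le hst
      (fun σ hσ => (hu.hasDeriv σ (hsub hσ)).continuousWithinAt.mono hsub) (fun σ hσ => ?_) hint'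
    have hσ' : σ ∈ Set.Icc 0 T := hsub (Set.Ioo_subset_Icc_self hσ)
    have h := (hu.hasDeriv σ hσ').hasDerivAt
      (Icc_mem_nhds (hs.1.trans_lt hσ.1) (hσ.2.trans_le ht.2))
    refine h.congr_deriv ?_
    rw [Pi.add_apply, map_add, (h₁ σ hσ').2, (h₂ σ hσ').2]
    rfl
  · have h := intervalIntegral.norm_integral_le_of_norm_le_const (a := s) (b := t) (C := |C|)
      (f := w₁ + w₂) fun σ hσ => by
        rw [Set.uIoc_of_le hst] at hσ
        exact (hC σ ⟨hs.1.trans hσ.1.le, hσ.2.trans ht.2⟩).trans (le_abs_self C)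
    rwa [abs_of_nonneg (sub_nonneg.2 hst)] at h

variable [CompleteSpace X] [CompleteSpace Z]

/-- The recurrence consumes `p - 1` of the `m ≥ p` powers of `t`, which leaves the factor `t`. -/
lemma IsCompatible.exists_pow_smul_phi_mem (hZ : IsCompatible (kerRestrict A bd) S ι T p)
    (hι : Function.Injective ι) (hJ : IsKerInverse A bd J) (hS : S.IsGenerator (kerRestrict A bd))
    (hp : 1 ≤ p) {m : ℕ} (hm : p ≤ m) (j : ℕ) :
    ∃ C : ℝ, 0 ≤ C ∧ ∀ t ∈ Set.Ioc 0 T, ∀ z : Z, ∃ w : Z,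
      ι w = t ^ m • S.phi (m + j) t (ι z) ∧ ‖w‖ ≤ C * t * ‖z‖ := by
  obtain ⟨C, hC0, hC⟩ := hZ.exists_pow_phi_mem_of_le hι hJ hS (N := m + j) (by omega)
  refine ⟨|T| ^ (m - p) * C, by positivity, fun t ht z => ?_⟩
  obtain ⟨w, hw, hwn⟩ := hC t ht z
  have ht0 := ht.1.le
  refine ⟨t ^ (m - p + 1) • w, ?_, ?_⟩
  · rw [ContinuousLinearMap.map_smul_of_tower, hw, smul_smul, ← pow_add,
      show m - p + 1 + (p - 1) = m by omega]
  · rw [norm_smul, Real.norm_of_nonneg (by positivity)]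
    calc t ^ (m - p + 1) * ‖w‖ ≤ (|T| ^ (m - p) * t) * (C * ‖z‖) := by
          rw [pow_succ]
          gcongr
          exact ht.2.trans (le_abs_self T)
      _ = _ := by ring

/-- `v(τ) = v̂(τ) + τ^m φ_{m+j}(τ A₀) A^m α` differs from `v(0) = α / j!` by `O(τ)` in the smoother
space. -/
lemma IsCompatible.exists_vhat_add_phi_mem (hZ : IsCompatible (kerRestrict A bd) S ι T p)
    (hι : Function.Injective ι) (hJ : IsKerInverse A bd J) (hS : S.IsGenerator (kerRestrict A bd))
    (hp : 1 ≤ p) {m : ℕ} (hm : p ≤ m) (j : ℕ) {K : ℝ} (hK : 0 ≤ K) :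
    ∃ C : ℝ, 0 ≤ C ∧ ∀ t ∈ Set.Ioc 0 T, ∀ (α : X) (a : ℕ → Z),
      (∀ l ≤ m, ι (a l) = (app A)^[l] α ∧ ‖a l‖ ≤ K) → ∃ w : Z,
      ι w = vhat A m j α t + t ^ m • S.phi (m + j) t ((app A)^[m] α) - (1 / (j.factorial : ℝ)) • α
        ∧ ‖w‖ ≤ C * t := by
  obtain ⟨C, hC0, hC⟩ := hZ.exists_pow_smul_phi_mem hι hJ hS hp hm j
  obtain ⟨m, rfl⟩ : ∃ m', m = m' + 1 := ⟨m - 1, by omega⟩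
  refine ⟨∑ l ∈ Finset.range m, |T| ^ l * K + C * K, by positivity, fun t ht α a ha => ?_⟩
  obtain ⟨w, hw, hwn⟩ := hC t ht (a (m + 1))
  rw [(ha _ le_rfl).1] at hw
  have ht0 := ht.1.le
  have htT : t ≤ |T| := ht.2.trans (le_abs_self T)
  refine ⟨∑ l ∈ Finset.range m, (t ^ (l + 1) / ((l + 1 + j).factorial : ℝ)) • a (l + 1) + w, ?_, ?_⟩
  · rw [map_add, hw, vhat, Finset.sum_range_succ', map_sum]
    have h : ∀ l ∈ Finset.range m, ι ((t ^ (l + 1) / ((l + 1 + j).factorial : ℝ)) • a (l + 1))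
        = (t ^ (l + 1) / ((l + 1 + j).factorial : ℝ)) • (app A)^[l + 1] α := fun l hl => by
      rw [ContinuousLinearMap.map_smul_of_tower, (ha (l + 1) (by
        have := Finset.mem_range.1 hl; omega)).1]
    rw [Finset.sum_congr rfl h]
    simp only [pow_zero, zero_add, Function.iterate_zero, id]
    abel
  · have h : ∀ l ∈ Finset.range m,
        ‖(t ^ (l + 1) / ((l + 1 + j).factorial : ℝ)) • a (l + 1)‖ ≤ |T| ^ l * K * t := fun l hl => by
      have h1 : t ^ (l + 1) / ((l + 1 + j).factorial : ℝ) ≤ |T| ^ l * t := by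
        refine (div_le_self (by positivity) ?_).trans ?_
        · exact_mod_cast Nat.one_le_iff_ne_zero.2 (l + 1 + j).factorial_ne_zero
        · rw [pow_succ]; gcongr
      have h2 := (ha (l + 1) (by have := Finset.mem_range.1 hl; omega)).2
      rw [norm_smul, Real.norm_of_nonneg (by positivity)]
      calc _ ≤ (|T| ^ l * t) * K := by gcongr
        _ = _ := by ring
    calc _ ≤ _ := norm_add_le _ _
      _ ≤ ∑ l ∈ Finset.range m, |T| ^ l * K * t + C * t * K := by
          refine add_le_add ((norm_sum_le _ _).trans (Finset.sum_le_sum h)) (hwn.trans ?_)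
          have := (ha (m + 1) le_rfl).2
          have := ht.1.le
          gcongr
      _ = _ := by rw [← Finset.sum_mul]; ring

end LocalError

section FullError

variable {X Y Z : Type*} [NormedAddCommGroup X] [NormedSpace ℂ X]
  [NormedAddCommGroup Y] [NormedSpace ℂ Y] [NormedAddCommGroup Z] [NormedSpace ℂ Z]
  {A : X →ₗ.[ℂ] X} {bd : A.domain →ₗ[ℂ] Y} {ι : Z →L[ℂ] X}
  {J : X →L[ℂ] X} {S : C0Semigroup X} {T : ℝ} {p : ℕ}

lemma seminorm_sum_smul_le {E : Type*} [SeminormedAddCommGroup E] [NormedSpace ℝ E] {s : ℕ}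
    (q : Seminorm ℝ E) (b : Fin s → Fin s → ℝ) {x : Fin s → Fin s → E} {C : Fin s → ℝ}
    (hx : ∀ i j, q (x i j) ≤ C j) :
    q (∑ i, ∑ j, b i j • x i j) ≤ ∑ i, ∑ j, |b i j| * C j := by
  have hsum : ∀ y : Fin s → E, q (∑ i, y i) ≤ ∑ i, q (y i) := fun y =>
    Finset.le_sum_of_subadditive q (map_zero q).le (map_add_le_add q) Finset.univ y
  refine (hsum _).trans (Finset.sum_le_sum fun i _ => (hsum _).trans (Finset.sum_le_sum fun j _ => ?_))
  rw [map_smul_eq_mul, Real.norm_eq_abs]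
  exact mul_le_mul_of_nonneg_left (hx i j) (abs_nonneg _)

/-- The exact solution `v̂(τ) + τ^m φ_{m+j}(τ A₀) A^m α` of the auxiliary problem of index `j`. -/
def exactV (A : X →ₗ.[ℂ] X) (S : C0Semigroup X) (m j : ℕ) (α : X) (τ : ℝ) : X :=
  vhat A m j α τ + τ ^ m • S.phi (m + j) τ ((app A)^[m] α)

lemma rho_eq (A : X →ₗ.[ℂ] X) (S : C0Semigroup X) {s : ℕ} (c : Fin s → ℝ) (p : ℕ) (f u : ℝ → X)
    (k : ℝ) (n : ℕ) : rho A S c p f u k n = u ((n + 1) * k) - (exactV A S (p + 1) 0 (u (n * k)) k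
      + k • ∑ i, ∑ j : Fin s, coeffA c i j • exactV A S p (j + 1) (f (n * k + c i * k)) k) := rfl

lemma node_mem_Icc {n : ℕ} {k θ : ℝ} (hk : 0 < k) (hn : ((n : ℝ) + 1) * k ≤ T)
    (hθ : θ ∈ Set.Icc (0 : ℝ) 1) : (n : ℝ) * k + θ * k ∈ Set.Icc 0 T := by
  have h0 : 0 ≤ (n : ℝ) * k := by positivity
  have h1 : 0 ≤ θ * k := mul_nonneg hθ.1 hk.le
  have h2 : θ * k ≤ 1 * k := mul_le_mul_of_nonneg_right hθ.2 hk.le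
  exact ⟨add_nonneg h0 h1, by linarith⟩

lemma grid_mem_Icc {n : ℕ} {k : ℝ} (hk : 0 < k) (hn : ((n : ℝ) + 1) * k ≤ T) :
    (n : ℝ) * k ∈ Set.Icc 0 T := by
  simpa using node_mem_Icc hk hn (θ := 0) (by simp)

variable [CompleteSpace X]

lemma exactV_mem (hJ : IsKerInverse A bd J) (hS : S.IsGenerator (kerRestrict A bd))
    {m j N : ℕ} {α : X} {τ : ℝ} (hα : DomPow A m α) (hN : m + j = N + 1) (hτ : 0 < τ) :
    exactV A S m j α τ ∈ A.domain := by
  have h := real_smul_mem _ (τ ^ j)⁻¹ (traj_mem hJ hS hα hN hτ.le)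
  rwa [traj_eq A S m j α hτ, inv_smul_smul₀ (pow_ne_zero _ hτ.ne')] at h

lemma rho_mem (hJ : IsKerInverse A bd J) (hS : S.IsGenerator (kerRestrict A bd))
    {f u : ℝ → X} (huZ : ZRegular A ι T (p + 1) u) (hfZ : ZRegular A ι T p f)
    {s : ℕ} {c : Fin s → ℝ} (hc01 : ∀ i, c i ∈ Set.Icc (0 : ℝ) 1)
    {n : ℕ} {k : ℝ} (hk : 0 < k) (hn : ((n : ℝ) + 1) * k ≤ T) :
    rho A S c p f u k n ∈ A.domain := by
  obtain ⟨Ku, hKu, huK⟩ := huZ.exists_bound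
  obtain ⟨Kf, hKf, hfK⟩ := hfZ.exists_bound
  rw [rho_eq]
  refine A.domain.sub_mem ((huK _ ⟨by positivity, hn⟩).1 0 p.succ_pos) (A.domain.add_mem
    (exactV_mem hJ hS (huK _ (grid_mem_Icc hk hn)).1 (add_zero (p + 1)) hk) (real_smul_mem _ _ ?_))
  exact A.domain.sum_mem fun i _ => A.domain.sum_mem fun j _ => real_smul_mem _ _
    (exactV_mem hJ hS (hfK _ (node_mem_Icc hk hn (hc01 i))).1 (add_assoc p j 1).symm hk)

variable [CompleteSpace Z]

/-- The factor `k` comes from the integration of the error equation over `[0, k]`, and from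
`v(k) - v(0) = O(k)` in the smoother space. -/
lemma exists_vbar0_bound (hZ : IsCompatible (kerRestrict A bd) S ι T p)
    (hι : Function.Injective ι) (hJ : IsKerInverse A bd J) (hS : S.IsGenerator (kerRestrict A bd))
    (hp : 1 ≤ p) {u : ℝ → X} (huZ : ZRegular A ι T (p + 1) u) {M : ℝ} (hM : 0 ≤ M) :
    ∃ C : ℝ, 0 ≤ C ∧ ∀ (D : SpaceDisc X Y) (ε : ℝ), D.Bounds bd ι M ε →
      ∀ t ∈ Set.Icc 0 T, ∀ k ∈ Set.Ioc 0 T, ∀ V, IsVbar0 D bd p (u t) k V →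
        D.q (V k - D.Rh bd (exactV A S (p + 1) 0 (u t) k)) ≤ C * (k * ε) := by
  obtain ⟨K, hK, huK⟩ := huZ.exists_bound
  obtain ⟨C, hC0, hC⟩ := hZ.exists_vhat_add_phi_mem hι hJ hS hp (Nat.le_succ p) 0 hK
  refine ⟨3 * M * (C * |T| + K + C), by positivity, fun D ε hD t ht k hk V hV => ?_⟩
  obtain ⟨hα, a, ha⟩ := huK t ht
  have htraj : ∀ τ, 0 < τ → traj A S (p + 1) 0 (u t) τ = exactV A S (p + 1) 0 (u t) τ :=
    fun τ hτ => by rw [traj_eq A S _ _ _ hτ, pow_zero, one_smul]; rfl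
  have ha0 : ι (a 0) = u t := (ha 0 (Nat.zero_le _)).1
  have hCT : 0 ≤ C * |T| := by positivity
  rw [← htraj k hk.1]
  refine hD.vbar0_error hJ hS hα hk.1 hV ha0 (((ha 0 (Nat.zero_le _)).2).trans (by linarith))
    (fun τ hτ => ?_) ?_
  · have hτT : τ ∈ Set.Ioc 0 T := ⟨hτ.1, hτ.2.trans hk.2⟩
    obtain ⟨w, hw, hwn⟩ := hC τ hτT (u t) a ha
    refine ⟨w + a 0, ?_, ?_⟩
    · rw [map_add, hw, ha0, htraj τ hτ.1, exactV]
      simp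
    · have h1 : C * τ ≤ C * |T| := by
        have := hτT.2.trans (le_abs_self T)
        gcongr
      have h2 := (ha 0 (Nat.zero_le _)).2
      have h3 := norm_add_le w (a 0)
      linarith
  · obtain ⟨w, hw, hwn⟩ := hC k hk (u t) a ha
    refine ⟨w, ?_, hwn.trans ?_⟩
    · rw [hw, htraj k hk.1, exactV]
      simp
    · exact mul_le_mul_of_nonneg_right (by linarith) hk.1.le

lemma exists_exactV_mem (hZ : IsCompatible (kerRestrict A bd) S ι T p)
    (hι : Function.Injective ι) (hJ : IsKerInverse A bd J) (hS : S.IsGenerator (kerRestrict A bd))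
    (hp : 1 ≤ p) (j : ℕ) {K : ℝ} (hK : 0 ≤ K) :
    ∃ C : ℝ, 0 ≤ C ∧ ∀ τ ∈ Set.Ioc 0 T, ∀ (α : X) (a : ℕ → Z),
      (∀ l ≤ p, ι (a l) = (app A)^[l] α ∧ ‖a l‖ ≤ K) →
      ∃ w : Z, ι w = exactV A S p j α τ ∧ ‖w‖ ≤ C := by
  obtain ⟨C, hC0, hC⟩ := hZ.exists_vhat_add_phi_mem hι hJ hS hp le_rfl j hK
  refine ⟨C * |T| + K, by positivity, fun τ hτ α a ha => ?_⟩
  obtain ⟨w, hw, hwn⟩ := hC τ hτ α a ha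
  have ha0 : ι (a 0) = α := (ha 0 (Nat.zero_le _)).1
  refine ⟨w + (1 / (j.factorial : ℝ)) • a 0, ?_, ?_⟩
  · rw [map_add, hw, ContinuousLinearMap.map_smul_of_tower, ha0, sub_add_cancel, exactV]
  · have h1 : C * τ ≤ C * |T| := by
      have := hτ.2.trans (le_abs_self T)
      gcongr
    have h2 := (ha 0 (Nat.zero_le _)).2
    have h3 : ‖(1 / (j.factorial : ℝ)) • a 0‖ ≤ 1 * K := by
      rw [norm_smul, Real.norm_of_nonneg (by positivity)]
      refine mul_le_mul ?_ h2 (norm_nonneg _) zero_le_one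
      refine div_le_one_of_le₀ ?_ (by positivity)
      exact_mod_cast Nat.one_le_iff_ne_zero.2 j.factorial_ne_zero
    have h4 := norm_add_le w ((1 / (j.factorial : ℝ)) • a 0)
    linarith

/-- A bound without the factor `k` suffices here, because the scheme multiplies these solutions
by `k`. -/
lemma exists_vbar_bound (hZ : IsCompatible (kerRestrict A bd) S ι T p)
    (hι : Function.Injective ι) (hJ : IsKerInverse A bd J) (hS : S.IsGenerator (kerRestrict A bd))
    (hp : 1 ≤ p) {f : ℝ → X} (hfZ : ZRegular A ι T p f) {M : ℝ} (hM : 0 ≤ M) (hT : 0 ≤ T) (j : ℕ) :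
    ∃ C : ℝ, 0 ≤ C ∧ ∀ (D : SpaceDisc X Y) (ε : ℝ), D.Bounds bd ι M ε →
      ∀ t ∈ Set.Icc 0 T, ∀ k ∈ Set.Ioc 0 T, ∀ V, IsVbar D bd p (j + 1) (f t) k V →
        D.q (V k - D.Rh bd (exactV A S p (j + 1) (f t) k)) ≤ C * ε := by
  obtain ⟨K, hK, hfK⟩ := hfZ.exists_bound
  obtain ⟨C, hC0, hC⟩ := exists_exactV_mem hZ hι hJ hS hp (j + 1) hK
  refine ⟨M * (T + M + 1) * (C + K), by positivity, fun D ε hD t ht k hk V hV => ?_⟩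
  obtain ⟨hα, a, ha⟩ := hfK t ht
  have ha0 : ι (a 0) = f t := (ha 0 (Nat.zero_le _)).1
  refine hD.vbar_error hJ hS hα (hα 0 hp) hk.1 hk.2 hV ha0
    (((ha 0 (Nat.zero_le _)).2).trans (by linarith)) (fun τ hτ => traj_eq A S p (j + 1) (f t) hτ.1)
    (fun τ hτ => exactV_mem hJ hS hα (add_assoc p j 1).symm hτ.1) fun τ hτ => ?_
  obtain ⟨w, hw, hwn⟩ := hC τ ⟨hτ.1, hτ.2.trans hk.2⟩ (f t) a ha
  exact ⟨w, hw, hwn.trans (by linarith)⟩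

/-- In the smoother space the local error of the time semidiscretization is `O(k)`. -/
lemma exists_rho_mem (hZ : IsCompatible (kerRestrict A bd) S ι T p)
    (hι : Function.Injective ι) (hJ : IsKerInverse A bd J) (hS : S.IsGenerator (kerRestrict A bd))
    (hp : 1 ≤ p) {f u : ℝ → X} {g : ℝ → Y} {u₀ : X} (hu : IsSolution A bd T f g u₀ u)
    (huZ : ZRegular A ι T (p + 1) u) (hfZ : ZRegular A ι T p f)
    {s : ℕ} {c : Fin s → ℝ} (hc01 : ∀ i, c i ∈ Set.Icc (0 : ℝ) 1) :
    ∃ C : ℝ, 0 ≤ C ∧ ∀ (n : ℕ) (k : ℝ), 0 < k → ((n : ℝ) + 1) * k ≤ T →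
      ∃ w : Z, ι w = rho A S c p f u k n ∧ ‖w‖ ≤ C * k := by
  obtain ⟨Ku, hKu, huK⟩ := huZ.exists_bound
  obtain ⟨Kf, hKf, hfK⟩ := hfZ.exists_bound
  obtain ⟨C₁, hC₁, h₁⟩ := hu.exists_increment huZ hfZ
  obtain ⟨C₂, hC₂, h₂⟩ := hZ.exists_vhat_add_phi_mem hι hJ hS hp (Nat.le_succ p) 0 hKu
  have hV : ∀ j : Fin s, ∃ C : ℝ, 0 ≤ C ∧ ∀ τ ∈ Set.Ioc 0 T, ∀ (α : X) (a : ℕ → Z),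
      (∀ l ≤ p, ι (a l) = (app A)^[l] α ∧ ‖a l‖ ≤ Kf) →
      ∃ w : Z, ι w = exactV A S p (j + 1) α τ ∧ ‖w‖ ≤ C := fun j =>
    exists_exactV_mem hZ hι hJ hS hp (j + 1) hKf
  choose C₃ hC₃ h₃ using hV
  have hsum0 : 0 ≤ ∑ i, ∑ j, |coeffA c i j| * C₃ j :=
    Finset.sum_nonneg fun i _ => Finset.sum_nonneg fun j _ => mul_nonneg (abs_nonneg _) (hC₃ j)
  refine ⟨C₁ + C₂ + ∑ i, ∑ j, |coeffA c i j| * C₃ j, by positivity, fun n k hk hn => ?_⟩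
  have hkT : k ∈ Set.Ioc 0 T := ⟨hk, by nlinarith [mul_nonneg (Nat.cast_nonneg (α := ℝ) n) hk.le]⟩
  have htn := grid_mem_Icc hk hn
  obtain ⟨w₁, hw₁, hn₁⟩ := h₁ _ htn ((n + 1) * k) ⟨by positivity, hn⟩ (by linarith)
  obtain ⟨-, a, ha⟩ := huK _ htn
  obtain ⟨w₂, hw₂, hn₂⟩ := h₂ k hkT _ a ha
  have hW : ∀ i j : Fin s, ∃ w : Z,
      ι w = exactV A S p (j + 1) (f (n * k + c i * k)) k ∧ ‖w‖ ≤ C₃ j := fun i j => by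
    obtain ⟨-, a, ha⟩ := hfK _ (node_mem_Icc hk hn (hc01 i))
    exact h₃ j k hkT _ a ha
  choose w₃ hw₃ hn₃ using hW
  refine ⟨w₁ - w₂ - k • ∑ i, ∑ j, coeffA c i j • w₃ i j, ?_, ?_⟩
  · rw [rho_eq, map_sub, map_sub, hw₁, hw₂, ContinuousLinearMap.map_smul_of_tower, map_sum]
    simp only [map_sum, ContinuousLinearMap.map_smul_of_tower, hw₃]
    rw [exactV]
    simp
    abel
  · have h := seminorm_sum_smul_le (normSeminorm ℝ Z) (coeffA c) hn₃
    rw [coe_normSeminorm] at h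
    have h4 : ‖k • ∑ i, ∑ j, coeffA c i j • w₃ i j‖ ≤ k * ∑ i, ∑ j, |coeffA c i j| * C₃ j := by
      rw [norm_smul, Real.norm_of_nonneg hk.le]
      exact mul_le_mul_of_nonneg_left h hk.le
    have h5 : C₁ * (((n : ℝ) + 1) * k - n * k) = C₁ * k := by ring
    rw [h5] at hn₁
    have h6 := norm_sub_le (w₁ - w₂) (k • ∑ i, ∑ j, coeffA c i j • w₃ i j)
    have h7 := norm_sub_le w₁ w₂
    linarith

/-- Up to `O(k ε_h)`, the local error of the full discretization is bounded by
`P_h` of the local error of the time semidiscretization. -/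
lemma exists_full_error_bound (hZ : IsCompatible (kerRestrict A bd) S ι T p)
    (hι : Function.Injective ι) (hJ : IsKerInverse A bd J) (hS : S.IsGenerator (kerRestrict A bd))
    (hp : 1 ≤ p) {f u : ℝ → X} {g : ℝ → Y} {u₀ : X} (hu : IsSolution A bd T f g u₀ u)
    (huZ : ZRegular A ι T (p + 1) u) (hfZ : ZRegular A ι T p f)
    {s : ℕ} {c : Fin s → ℝ} (hc01 : ∀ i, c i ∈ Set.Icc (0 : ℝ) 1) {M : ℝ} (hM : 0 ≤ M)
    (hT : 0 ≤ T) :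
    ∃ C : ℝ, 0 ≤ C ∧ ∀ (D : SpaceDisc X Y) (ε : ℝ), D.Bounds bd ι M ε →
      ∀ (n : ℕ) (k : ℝ), 0 < k → ((n : ℝ) + 1) * k ≤ T → ∀ r : D.Xh0,
        IsFullLocalError D bd c p f u k n r →
          D.q r ≤ D.q (D.Ph bd (rho A S c p f u k n)) + C * (k * ε) := by
  obtain ⟨Ku, -, huK⟩ := huZ.exists_bound
  obtain ⟨Kf, -, hfK⟩ := hfZ.exists_bound
  obtain ⟨C₁, hC₁, h₁⟩ := exists_rho_mem hZ hι hJ hS hp hu huZ hfZ hc01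
  obtain ⟨C₂, hC₂, h₂⟩ := exists_vbar0_bound hZ hι hJ hS hp huZ hM
  choose C₃ hC₃ h₃ using fun j : Fin s => exists_vbar_bound hZ hι hJ hS hp hfZ hM hT j
  have hsum0 : 0 ≤ ∑ i, ∑ j, |coeffA c i j| * C₃ j :=
    Finset.sum_nonneg fun i _ => Finset.sum_nonneg fun j _ => mul_nonneg (abs_nonneg _) (hC₃ j)
  refine ⟨M * C₁ + C₂ + ∑ i, ∑ j, |coeffA c i j| * C₃ j, by positivity,
    fun D ε hD n k hk hn r hr => ?_⟩
  obtain ⟨V₀, V, hV₀, hV, rfl⟩ := hr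
  have hε := hD.eps_nonneg
  have hkT : k ∈ Set.Ioc 0 T := ⟨hk, by nlinarith [mul_nonneg (Nat.cast_nonneg (α := ℝ) n) hk.le]⟩
  have htn := grid_mem_Icc hk hn
  have hR := D.isLinearOn_Rh bd
  have hud : u ((n + 1) * k) ∈ A.domain := (huK _ ⟨by positivity, hn⟩).1 0 p.succ_pos
  have hv₀d : exactV A S (p + 1) 0 (u (n * k)) k ∈ A.domain :=
    exactV_mem hJ hS (huK _ htn).1 (add_zero (p + 1)) hk
  have hvd : ∀ i j : Fin s, exactV A S p (j + 1) (f (n * k + c i * k)) k ∈ A.domain := fun i j =>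
    exactV_mem hJ hS (hfK _ (node_mem_Icc hk hn (hc01 i))).1 (add_assoc p j 1).symm hk
  have hinner : ∀ i : Fin s, ∑ j : Fin s,
      coeffA c i j • exactV A S p (j + 1) (f (n * k + c i * k)) k ∈ A.domain := fun i =>
    A.domain.sum_mem fun j _ => real_smul_mem _ _ (hvd i j)
  have hsumd : ∑ i, ∑ j : Fin s, coeffA c i j • exactV A S p (j + 1) (f (n * k + c i * k)) k
      ∈ A.domain := A.domain.sum_mem fun i _ => hinner i
  have hRsum : D.Rh bd (∑ i, ∑ j : Fin s,
        coeffA c i j • exactV A S p (j + 1) (f (n * k + c i * k)) k)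
      = ∑ i, ∑ j : Fin s,
        coeffA c i j • D.Rh bd (exactV A S p (j + 1) (f (n * k + c i * k)) k) := by
    have h := hR.sum Finset.univ (fun _ : Fin s => (1 : ℝ)) (fun i => ∑ j : Fin s,
      coeffA c i j • exactV A S p (j + 1) (f (n * k + c i * k)) k) fun i _ => hinner i
    simp only [one_smul] at h
    rw [h]
    exact Finset.sum_congr rfl fun i _ => hR.sum _ _ _ fun j _ => hvd i j
  -- `R_h` is linear on `D(A)`, so `ρ_{h,n}` is `R_h ρ_n` minus the errors of the discrete solutions
  have hsplit : D.Rh bd (u ((n + 1) * k)) - (V₀ k + k • ∑ i, ∑ j, coeffA c i j • V i j k)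
      = D.Rh bd (rho A S c p f u k n)
        - ((V₀ k - D.Rh bd (exactV A S (p + 1) 0 (u (n * k)) k))
          + k • ∑ i, ∑ j : Fin s, coeffA c i j •
            (V i j k - D.Rh bd (exactV A S p (j + 1) (f (n * k + c i * k)) k))) := by
    rw [rho_eq, hR.sub hud (A.domain.add_mem hv₀d (real_smul_mem _ _ hsumd)),
      hR.add _ hv₀d _ (real_smul_mem _ _ hsumd), hR.smul _ _ hsumd, hRsum]
    simp only [smul_sub, Finset.sum_sub_distrib]
    abel
  obtain ⟨w, hw, hwn⟩ := h₁ n k hk hn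
  have hρd := rho_mem (c := c) hJ hS huZ hfZ hc01 hk hn
  have e₁ := hD.q_Rh_sub_Ph_le (z := w) (hw ▸ hρd)
  rw [hw] at e₁
  have e₁' : D.q (D.Rh bd (rho A S c p f u k n) - D.Ph bd (rho A S c p f u k n))
      ≤ M * (ε * (C₁ * k)) := e₁.trans (by gcongr)
  have e₂ := h₂ D ε hD _ htn k hkT V₀ hV₀
  have e₃ := seminorm_sum_smul_le D.q (coeffA c) (C := fun j => C₃ j * ε)
    (x := fun i j => V i j k - D.Rh bd (exactV A S p (j + 1) (f (n * k + c i * k)) k))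
    fun i j => h₃ j D ε hD _ (node_mem_Icc hk hn (hc01 i)) k hkT (V i j) (hV i j)
  simp only [← mul_assoc, ← Finset.sum_mul] at e₃
  have e₃' : D.q (k • ∑ i, ∑ j : Fin s, coeffA c i j •
      (V i j k - D.Rh bd (exactV A S p (j + 1) (f (n * k + c i * k)) k)))
      ≤ k * ((∑ i, ∑ j, |coeffA c i j| * C₃ j) * ε) := by
    rw [map_smul_eq_mul, Real.norm_of_nonneg hk.le]
    exact mul_le_mul_of_nonneg_left e₃ hk.le
  rw [hsplit, ← sub_add_cancel (D.Rh bd (rho A S c p f u k n)) (D.Ph bd (rho A S c p f u k n))]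
  refine (map_sub_le_add D.q _ _).trans ?_
  have f₁ := map_add_le_add D.q
    (D.Rh bd (rho A S c p f u k n) - D.Ph bd (rho A S c p f u k n))
    (D.Ph bd (rho A S c p f u k n))
  have f₂ := map_add_le_add D.q (V₀ k - D.Rh bd (exactV A S (p + 1) 0 (u (n * k)) k))
    (k • ∑ i, ∑ j : Fin s, coeffA c i j •
      (V i j k - D.Rh bd (exactV A S p (j + 1) (f (n * k + c i * k)) k)))
  linarith

end FullError

/-! ### Taylor expansion of the local error of the time semidiscretization -/

section Taylor

/-- Taylor's formula with a bound for the remainder, for a chain of functions each of which is the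
derivative of the preceding one. -/
lemma norm_sub_taylor_le {E : Type*} [NormedAddCommGroup E] [NormedSpace ℝ E] {T C : ℝ} {N : ℕ}
    {F : ℕ → ℝ → E} (hF : ∀ j < N, ∀ t ∈ Set.Icc 0 T,
      HasDerivWithinAt (F j) (F (j + 1) t) (Set.Icc 0 T) t)
    (hC : ∀ t ∈ Set.Icc 0 T, ‖F N t‖ ≤ C) {a t : ℝ} (ha : 0 ≤ a) (hat : a ≤ t) (ht : t ≤ T) :
    ‖F 0 t - ∑ j ∈ Finset.range N, ((t - a) ^ j / (j.factorial : ℝ)) • F j a‖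
      ≤ C * (t - a) ^ N := by
  induction N generalizing F t with
  | zero => simpa using hC t ⟨ha.trans hat, ht⟩
  | succ N ih =>
    have hC0 : 0 ≤ C := (norm_nonneg _).trans (hC t ⟨ha.trans hat, ht⟩)
    set G : ℝ → E := fun σ =>
      F 0 σ - ∑ j ∈ Finset.range (N + 1), ((σ - a) ^ j / (j.factorial : ℝ)) • F j a with hG
    have hGa : G a = 0 := by simp [hG, Finset.sum_range_succ']
    have hd : ∀ σ ∈ Set.Icc a t, HasDerivWithinAt G (F 1 σ
        - ∑ j ∈ Finset.range N, ((σ - a) ^ j / (j.factorial : ℝ)) • F (j + 1) a)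
        (Set.Icc a t) σ := by
      intro σ hσ
      have h1 := (hF 0 N.succ_pos σ ⟨ha.trans hσ.1, hσ.2.trans ht⟩).mono
        (Set.Icc_subset_Icc ha ht)
      have h2 : ∀ j ∈ Finset.range N, HasDerivAt
          (fun σ : ℝ => ((σ - a) ^ (j + 1) / ((j + 1).factorial : ℝ)) • F (j + 1) a)
          (((σ - a) ^ j / (j.factorial : ℝ)) • F (j + 1) a) σ := fun j _ => by
        have h := ((((hasDerivAt_id σ).sub_const a).pow (j + 1)).div_const
          ((j + 1).factorial : ℝ)).smul_const (F (j + 1) a)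
        refine h.congr_deriv ?_
        congr 1
        have h3 : (j.factorial : ℝ) ≠ 0 := by positivity
        rw [Nat.factorial_succ]
        push_cast
        simp only [id, mul_one]
        field_simp
      have h3 := (HasDerivAt.fun_sum h2).add_const (((0 : ℕ).factorial : ℝ)⁻¹ • F 0 a)
      have h4 := h1.sub h3.hasDerivWithinAt
      refine h4.congr_of_mem (fun τ _ => ?_) hσ
      simp [hG, Finset.sum_range_succ']
    have hb : ∀ σ ∈ Set.Ico a t, ‖F 1 σ
        - ∑ j ∈ Finset.range N, ((σ - a) ^ j / (j.factorial : ℝ)) • F (j + 1) a‖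
        ≤ C * (t - a) ^ N := fun σ hσ => by
      refine (ih (F := fun j => F (j + 1)) (fun j hj => hF (j + 1) (Nat.succ_lt_succ hj)) hC hσ.1
        (hσ.2.le.trans ht)).trans ?_
      have h1 := sub_nonneg.2 hσ.1
      have h2 := hσ.2.le
      gcongr
    have h := norm_image_sub_le_of_norm_deriv_le_segment' hd hb t ⟨hat, le_rfl⟩
    rw [hGa, sub_zero] at h
    calc _ ≤ C * (t - a) ^ N * (t - a) := h
      _ = _ := by ring

variable {X Y : Type*} [NormedAddCommGroup X] [NormedSpace ℂ X]
  [NormedAddCommGroup Y] [NormedSpace ℂ Y]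
  {A : X →ₗ.[ℂ] X} {bd : A.domain →ₗ[ℂ] Y} {T : ℝ} {p : ℕ}
  {f : ℝ → X} {g : ℝ → Y} {u₀ : X} {u : ℝ → X}

lemma DomPow.app {m : ℕ} {x : X} (h : DomPow A (m + 1) x) : DomPow A m (app A x) := fun i hi => by
  rw [← Function.iterate_succ_apply]
  exact h (i + 1) (Nat.succ_lt_succ hi)

lemma tderiv_zero (T : ℝ) (u : ℝ → X) : tderiv T 0 u = u := by
  simp [tderiv]

/-- The inhomogeneity inherits its smoothness from `u`, through `f = u' - A u`. -/
lemma IsSolution.tderiv_source (hu : IsSolution A bd T f g u₀ u) (hreg : TimeRegular A T p u)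
    (hT : 0 < T) {r : ℕ} (hr : r ≤ p) {t : ℝ} (ht : t ∈ Set.Icc 0 T) :
    tderiv T r f t = tderiv T (r + 1) u t - app A (tderiv T r u t) := by
  have huniq := uniqueDiffOn_Icc hT
  induction r generalizing t with
  | zero =>
    have h1 := hreg.hasDeriv 0 0 (Nat.zero_le p) t ht
    have h2 := hu.hasDeriv t ht
    simp only [Function.iterate_zero, id, tderiv_zero] at h1
    rw [tderiv_zero, tderiv_zero, eq_sub_iff_add_eq, add_comm]
    exact (huniq t ht).eq_deriv _ h2 h1
  | succ r ih =>
    have h1 := hreg.hasDeriv (r + 1) 0 hr t ht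
    have h2 := hreg.hasDeriv r 1 hr t ht
    have h3 := h1.sub h2
    rw [tderiv, iteratedDerivWithin_succ]
    refine HasDerivWithinAt.derivWithin (h3.congr_of_mem (fun σ hσ => ?_) ht) (huniq t ht)
    exact ih (Nat.le_of_succ_le hr) hσ

lemma IsSolution.iterate_app_tderiv_source (hu : IsSolution A bd T f g u₀ u)
    (hreg : TimeRegular A T p u) (hT : 0 < T) {q r : ℕ} (hr : q + r ≤ p) {t : ℝ}
    (ht : t ∈ Set.Icc 0 T) : (app A)^[q] (tderiv T r f t)
      = (app A)^[q] (tderiv T (r + 1) u t) - (app A)^[q + 1] (tderiv T r u t) := by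
  rw [hu.tderiv_source hreg hT (by omega) ht, iterate_app_sub, ← Function.iterate_succ_apply]
  · exact domPow_of_le (hreg.mem_domain (r + 1) (by omega) t ht) (by omega)
  · exact DomPow.app (domPow_of_le (hreg.mem_domain r (by omega) t ht) (by omega))

lemma IsSolution.continuousOn_source (hu : IsSolution A bd T f g u₀ u)
    (hreg : TimeRegular A T p u) (hT : 0 < T) {q r : ℕ} (hr : q + r ≤ p) :
    ContinuousOn (fun t => (app A)^[q] (tderiv T r f t)) (Set.Icc 0 T) :=
  ((hreg.continuousOn (r + 1) q (by omega)).sub (hreg.continuousOn r (q + 1) (by omega))).congr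
    fun _ ht => hu.iterate_app_tderiv_source hreg hT hr ht

lemma IsSolution.hasDerivWithinAt_source (hu : IsSolution A bd T f g u₀ u)
    (hreg : TimeRegular A T p u) (hT : 0 < T) {q r : ℕ} (hr : q + (r + 1) ≤ p) {t : ℝ}
    (ht : t ∈ Set.Icc 0 T) : HasDerivWithinAt (fun t => (app A)^[q] (tderiv T r f t))
      ((app A)^[q] (tderiv T (r + 1) f t)) (Set.Icc 0 T) t := by
  rw [hu.iterate_app_tderiv_source hreg hT hr ht]
  exact ((hreg.hasDeriv (r + 1) q (by omega) t ht).sub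
    (hreg.hasDeriv r (q + 1) (by omega) t ht)).congr_of_mem
    (fun σ hσ => hu.iterate_app_tderiv_source hreg hT (by omega) hσ) ht

/-- `u^{(m)} = A^m u + ∑_{r<m} A^{m-r-1} f^{(r)}`, by telescoping. -/
lemma IsSolution.tderiv_sub_iterate_app (hu : IsSolution A bd T f g u₀ u)
    (hreg : TimeRegular A T p u) (hT : 0 < T) {m : ℕ} (hm : m ≤ p + 1) {t : ℝ}
    (ht : t ∈ Set.Icc 0 T) : tderiv T m u t - (app A)^[m] (u t)
      = ∑ r ∈ Finset.range m, (app A)^[m - r - 1] (tderiv T r f t) := by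
  have h := Finset.sum_range_sub (fun r => (app A)^[m - r] (tderiv T r u t)) m
  simp only [Nat.sub_self, Nat.sub_zero, Function.iterate_zero, id, tderiv_zero] at h
  rw [← h]
  refine Finset.sum_congr rfl fun r hr => ?_
  have hrm := Finset.mem_range.1 hr
  rw [hu.iterate_app_tderiv_source hreg hT (by omega) ht, Nat.sub_add_eq,
    Nat.sub_add_cancel (by omega : 1 ≤ m - r)]

lemma sum_smul_sum_comm {E : Type*} [AddCommGroup E] [Module ℝ E] {s : ℕ} (p : ℕ)
    (a : Fin s → Fin s → ℝ) (b : Fin s → Fin s → ℕ → ℕ → ℝ) (F : ℕ → ℕ → E) :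
    ∑ i, ∑ j, a i j • ∑ l ∈ Finset.range p, ∑ r ∈ Finset.range (p - l), b i j l r • F l r
      = ∑ l ∈ Finset.range p, ∑ r ∈ Finset.range (p - l),
          (∑ i, ∑ j, a i j * b i j l r) • F l r := by
  simp only [Finset.smul_sum, Finset.sum_smul, smul_smul]
  calc _ = ∑ i, ∑ l ∈ Finset.range p, ∑ j, ∑ r ∈ Finset.range (p - l),
        (a i j * b i j l r) • F l r := Finset.sum_congr rfl fun i _ => Finset.sum_comm
    _ = ∑ l ∈ Finset.range p, ∑ i, ∑ j, ∑ r ∈ Finset.range (p - l),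
        (a i j * b i j l r) • F l r := Finset.sum_comm
    _ = ∑ l ∈ Finset.range p, ∑ i, ∑ r ∈ Finset.range (p - l), ∑ j,
        (a i j * b i j l r) • F l r :=
      Finset.sum_congr rfl fun l _ => Finset.sum_congr rfl fun i _ => Finset.sum_comm
    _ = _ := Finset.sum_congr rfl fun l _ => Finset.sum_comm

/-- The coefficient of `k^m A^{m-r-1} f^{(r)}` in the expansion of the local error. The index `l`
starts at `0`, which shifts the factorial by one. -/
def orderCoeff {s : ℕ} (c : Fin s → ℝ) (m r : ℕ) : ℝ :=
  1 / (m.factorial : ℝ) - 1 / (r.factorial : ℝ) * ∑ l : Fin s,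
    1 / ((m - r - 1 + (l + 1)).factorial : ℝ) * ∑ i, c i ^ r * coeffA c i l

/-- Collecting powers of `k` in the Taylor polynomials of the solution and of the quadrature. -/
lemma sum_orderCoeff {E : Type*} [AddCommGroup E] [Module ℝ E] {s : ℕ} (c : Fin s → ℝ) (p : ℕ)
    (k : ℝ) (F : ℕ → ℕ → E) :
    ∑ m ∈ Finset.Icc 1 p, k ^ m • ∑ r ∈ Finset.range m, orderCoeff c m r • F (m - r - 1) r
      = ∑ m ∈ Finset.range (p + 1), (k ^ m / (m.factorial : ℝ)) •
          ∑ r ∈ Finset.range m, F (m - r - 1) r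
        - k • ∑ i, ∑ j : Fin s, coeffA c i j • ∑ l ∈ Finset.range p, ∑ r ∈ Finset.range (p - l),
            (k ^ l / ((l + (j + 1)).factorial : ℝ) * ((c i * k) ^ r / (r.factorial : ℝ))) • F l r := by
  have hIcc : ∀ G : ℕ → E, ∑ m ∈ Finset.Icc 1 p, G m = ∑ m ∈ Finset.range p, G (m + 1) := fun G => by
    rw [Finset.range_eq_Ico, Finset.sum_Ico_add' G 0 p 1]
    rfl
  rw [hIcc, Finset.sum_range_succ', sum_smul_sum_comm]
  simp only [Finset.range_zero, Finset.sum_empty, smul_zero, add_zero]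
  -- the double sum over `l + r < p` is arranged by the power `k ^ (l + r + 1)`
  have hflip : ∀ H : ℕ → ℕ → E, ∑ l ∈ Finset.range p, ∑ r ∈ Finset.range (p - l), H l r
      = ∑ m ∈ Finset.range p, ∑ r ∈ Finset.range (m + 1), H (m - r) r := fun H => by
    rw [Finset.sum_range_diag_flip p fun r l => H l r]
    refine Finset.sum_comm' fun l r => ?_
    simp only [Finset.mem_range]
    omega
  rw [hflip, Finset.smul_sum, ← Finset.sum_sub_distrib]
  refine Finset.sum_congr rfl fun m _ => ?_
  rw [Finset.smul_sum, Finset.smul_sum, Finset.smul_sum, ← Finset.sum_sub_distrib]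
  refine Finset.sum_congr rfl fun r hr => ?_
  have hrm : r ≤ m := Nat.lt_succ_iff.1 (Finset.mem_range.1 hr)
  have h1 : m + 1 - r - 1 = m - r := by omega
  rw [h1, smul_smul, smul_smul, ← sub_smul, orderCoeff, h1]
  congr 1
  rw [mul_sub, mul_one_div]
  congr 1
  rw [Finset.sum_comm]
  simp only [Finset.mul_sum]
  refine Finset.sum_congr rfl fun j _ => Finset.sum_congr rfl fun i _ => ?_
  have h2 : k ^ (m + 1) = k * (k ^ (m - r) * k ^ r) := by
    rw [← pow_add, Nat.sub_add_cancel hrm, pow_succ']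
  rw [h2, mul_pow]
  ring

end Taylor

section TimeError

variable {X Y : Type*} [NormedAddCommGroup X] [NormedSpace ℂ X] [CompleteSpace X]
  [NormedAddCommGroup Y] [NormedSpace ℂ Y]
  {A : X →ₗ.[ℂ] X} {bd : A.domain →ₗ[ℂ] Y} {S : C0Semigroup X} {T : ℝ} {p : ℕ}
  {f : ℝ → X} {g : ℝ → Y} {u₀ : X} {u : ℝ → X}

/-- Taylor expansion of `u` and of the values `A^l f` at the nodes, up to terms of order `k^{p+1}` in
the local error; the terms with `φ`-functions are of this order themselves. -/
lemma exists_rho_expansion (hS : S.type < 0) (hu : IsSolution A bd T f g u₀ u)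
    (hreg : TimeRegular A T p u) (hT : 0 < T) {s : ℕ} {c : Fin s → ℝ}
    (hc01 : ∀ i, c i ∈ Set.Icc (0 : ℝ) 1) :
    ∃ C : ℝ, ∀ (n : ℕ) (k : ℝ), 0 < k → ((n : ℝ) + 1) * k ≤ T →
      ‖rho A S c p f u k n - ∑ m ∈ Finset.Icc 1 p, k ^ m • ∑ r ∈ Finset.range m,
        orderCoeff c m r • (app A)^[m - r - 1] (tderiv T r f (n * k))‖ ≤ C * k ^ (p + 1) := by
  obtain ⟨M, hM0, hM⟩ := S.exists_norm_le_const hS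
  obtain ⟨C₁, hC₁⟩ := isCompact_Icc.exists_bound_of_continuousOn (hreg.continuousOn (p + 1) 0 le_rfl)
  obtain ⟨C₂, hC₂⟩ := isCompact_Icc.exists_bound_of_continuousOn
    (hreg.continuousOn 0 (p + 1) (by omega))
  have hf : ∀ q ≤ p, ∃ C, ∀ t ∈ Set.Icc 0 T, ‖(app A)^[q] (tderiv T (p - q) f t)‖ ≤ C := fun q hq =>
    isCompact_Icc.exists_bound_of_continuousOn (hu.continuousOn_source hreg hT (by omega))
  choose! C₃ hC₃ using hf
  obtain ⟨C₄, hC₄⟩ := isCompact_Icc.exists_bound_of_continuousOn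
    (hu.continuousOn_source hreg hT (q := p) (r := 0) le_rfl)
  set Q : ℝ := ∑ l ∈ Finset.range p, |C₃ l| + M * C₄ with hQ
  refine ⟨C₁ + M * C₂ + ∑ i, ∑ j, |coeffA c i j| * Q, fun n k hk hn => ?_⟩
  have ht := grid_mem_Icc hk hn
  set t : ℝ := n * k with htdef
  have hkpos := hk.le
  -- Taylor expansion of the solution
  have e₁ : ‖u ((n + 1) * k) - ∑ m ∈ Finset.range (p + 1),
      (k ^ m / (m.factorial : ℝ)) • tderiv T m u t‖ ≤ C₁ * k ^ (p + 1) := by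
    have h := norm_sub_taylor_le (F := fun j => tderiv T j u) (N := p + 1)
      (fun j hj σ hσ => hreg.hasDeriv j 0 (by omega) σ hσ) hC₁ ht.1
      (t := (n + 1) * k) (by linarith) hn
    rwa [show ((n : ℝ) + 1) * k - t = k by rw [htdef]; ring, tderiv_zero] at h
  have e₂ : ‖k ^ (p + 1) • S.phi (p + 1) k ((app A)^[p + 1] (u t))‖ ≤ M * C₂ * k ^ (p + 1) := by
    have h := hC₂ t ht
    rw [tderiv_zero] at h
    rw [norm_smul, Real.norm_of_nonneg (by positivity), mul_comm]
    exact mul_le_mul_of_nonneg_right ((S.norm_phi_le hM _ hk _).trans (by gcongr)) (by positivity)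
  -- Taylor expansion of the inhomogeneity at the nodes
  set E : Fin s → Fin s → X := fun i j =>
    ∑ l ∈ Finset.range p, (k ^ l / ((l + (j + 1)).factorial : ℝ)) •
      ((app A)^[l] (f (t + c i * k)) - ∑ r ∈ Finset.range (p - l),
        ((c i * k) ^ r / (r.factorial : ℝ)) • (app A)^[l] (tderiv T r f t))
      + k ^ p • S.phi (p + (j + 1)) k ((app A)^[p] (f (t + c i * k))) with hE
  have e₃ : ∀ i j, ‖E i j‖ ≤ Q * k ^ p := fun i j => by
    have hti := node_mem_Icc hk hn (hc01 i)
    have hci := (hc01 i).1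
    have h1 : ∀ l ∈ Finset.range p, ‖(k ^ l / ((l + (j + 1)).factorial : ℝ)) •
        ((app A)^[l] (f (t + c i * k)) - ∑ r ∈ Finset.range (p - l),
          ((c i * k) ^ r / (r.factorial : ℝ)) • (app A)^[l] (tderiv T r f t))‖
        ≤ |C₃ l| * k ^ p := fun l hl => by
      have hlp := Finset.mem_range.1 hl
      have h := norm_sub_taylor_le (F := fun r σ => (app A)^[l] (tderiv T r f σ)) (N := p - l)
        (fun r hr σ hσ => hu.hasDerivWithinAt_source hreg hT (by omega) hσ)
        (fun σ hσ => (hC₃ l hlp.le σ hσ).trans (le_abs_self _)) ht.1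
        (t := t + c i * k) (by nlinarith) hti.2
      rw [add_sub_cancel_left, tderiv_zero] at h
      have h2 : (c i * k) ^ (p - l) ≤ k ^ (p - l) :=
        pow_le_pow_left₀ (mul_nonneg hci hkpos) (mul_le_of_le_one_left hkpos (hc01 i).2) _
      have h3 : k ^ l / ((l + (j + 1 : ℕ)).factorial : ℝ) ≤ k ^ l := by
        refine div_le_self (by positivity) ?_
        exact_mod_cast Nat.one_le_iff_ne_zero.2 (Nat.factorial_ne_zero _)
      rw [norm_smul, Real.norm_of_nonneg (by positivity)]
      calc _ ≤ k ^ l * (|C₃ l| * k ^ (p - l)) := by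
            refine mul_le_mul h3 (h.trans ?_) (norm_nonneg _) (by positivity)
            gcongr
        _ = |C₃ l| * (k ^ l * k ^ (p - l)) := by ring
        _ = _ := by rw [← pow_add, Nat.add_sub_cancel' hlp.le]
    have h2 : ‖k ^ p • S.phi (p + (j + 1)) k ((app A)^[p] (f (t + c i * k)))‖
        ≤ M * C₄ * k ^ p := by
      have h := hC₄ _ hti
      rw [tderiv_zero] at h
      rw [norm_smul, Real.norm_of_nonneg (by positivity), mul_comm]
      exact mul_le_mul_of_nonneg_right ((S.norm_phi_le hM _ hk _).trans (by gcongr)) (by positivity)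
    calc ‖E i j‖ ≤ _ := norm_add_le _ _
      _ ≤ ∑ l ∈ Finset.range p, |C₃ l| * k ^ p + M * C₄ * k ^ p :=
        add_le_add ((norm_sum_le _ _).trans (Finset.sum_le_sum h1)) h2
      _ = _ := by rw [← Finset.sum_mul, hQ]; ring
  have e₄ : ‖k • ∑ i, ∑ j, coeffA c i j • E i j‖
      ≤ (∑ i, ∑ j, |coeffA c i j| * Q) * k ^ (p + 1) := by
    have h := seminorm_sum_smul_le (normSeminorm ℝ X) (coeffA c) (C := fun _ => Q * k ^ p) e₃
    rw [coe_normSeminorm] at h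
    simp only [← mul_assoc, ← Finset.sum_mul] at h
    rw [norm_smul, Real.norm_of_nonneg hkpos]
    simp only [← Finset.sum_mul]
    calc _ ≤ k * _ := mul_le_mul_of_nonneg_left h hkpos
      _ = _ := by ring
  have hsplit : rho A S c p f u k n - ∑ m ∈ Finset.Icc 1 p, k ^ m • ∑ r ∈ Finset.range m,
        orderCoeff c m r • (app A)^[m - r - 1] (tderiv T r f t)
      = (u ((n + 1) * k) - ∑ m ∈ Finset.range (p + 1),
          (k ^ m / (m.factorial : ℝ)) • tderiv T m u t)
        - k ^ (p + 1) • S.phi (p + 1) k ((app A)^[p + 1] (u t))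
        - k • ∑ i, ∑ j, coeffA c i j • E i j := by
    rw [sum_orderCoeff c p k fun l r => (app A)^[l] (tderiv T r f t), rho, timeStep]
    have h1 : ∑ m ∈ Finset.range (p + 1), (k ^ m / (m.factorial : ℝ)) •
          ∑ r ∈ Finset.range m, (app A)^[m - r - 1] (tderiv T r f t)
        = ∑ m ∈ Finset.range (p + 1), (k ^ m / (m.factorial : ℝ)) • tderiv T m u t
          - ∑ m ∈ Finset.range (p + 1), (k ^ m / (m.factorial : ℝ)) • (app A)^[m] (u t) := by
      rw [← Finset.sum_sub_distrib]
      refine Finset.sum_congr rfl fun m hm => ?_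
      rw [← hu.tderiv_sub_iterate_app hreg hT (Finset.mem_range.1 hm).le ht, smul_sub]
    rw [h1]
    simp only [hE, smul_sub, smul_add, Finset.sum_sub_distrib, Finset.sum_add_distrib,
      Finset.smul_sum, smul_smul]
    abel
  rw [hsplit]
  have f₁ := norm_sub_le ((u ((n + 1) * k) - ∑ m ∈ Finset.range (p + 1),
          (k ^ m / (m.factorial : ℝ)) • tderiv T m u t)
        - k ^ (p + 1) • S.phi (p + 1) k ((app A)^[p + 1] (u t)))
    (k • ∑ i, ∑ j, coeffA c i j • E i j)
  have f₂ := norm_sub_le (u ((n + 1) * k) - ∑ m ∈ Finset.range (p + 1),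
          (k ^ m / (m.factorial : ℝ)) • tderiv T m u t)
    (k ^ (p + 1) • S.phi (p + 1) k ((app A)^[p + 1] (u t)))
  linarith

end TimeError

/-! ### The order conditions -/

section Order

lemma iterInt_pow (l m : ℕ) (t : ℝ) : iterInt (fun x : ℝ => x ^ l) m t
    = (l.factorial : ℝ) / ((l + m).factorial : ℝ) * t ^ (l + m) := by
  induction m generalizing t with
  | zero =>
    have : (l.factorial : ℝ) ≠ 0 := by positivity
    simp [iterInt, this]
  | succ m ih =>
    simp only [iterInt, ih]
    rw [intervalIntegral.integral_const_mul, integral_pow, ← add_assoc l m 1, Nat.factorial_succ]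
    push_cast
    have : ((l + m).factorial : ℝ) ≠ 0 := by positivity
    field_simp
    simp

/-- The Beta integral with integer exponents. -/
lemma integral_one_sub_pow_mul_pow (q l : ℕ) :
    ∫ θ in (0 : ℝ)..1, (1 - θ) ^ q / (q.factorial : ℝ) * θ ^ l
      = (l.factorial : ℝ) / ((q + (l + 1)).factorial : ℝ) := by
  have h1 := iterInt_succ_eq (g := fun x : ℝ => x ^ l) (by fun_prop) q 1
  have h2 := intervalIntegral.integral_comp_sub_left (a := 0) (b := 1)
    (fun τ : ℝ => (τ ^ q / (q.factorial : ℝ)) • (1 - τ) ^ l) 1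
  simp only [sub_self, sub_zero, sub_sub_cancel, smul_eq_mul] at h1 h2
  rw [h2, ← h1, iterInt_pow, one_pow, mul_one, show l + (q + 1) = q + (l + 1) by ring]

/-- The sums in the order conditions are moments of the Lagrange polynomials. -/
lemma sum_coeffA_div {s : ℕ} {c : Fin s → ℝ} (hc : Function.Injective c) (q : ℕ) (i : Fin s) :
    ∑ l : Fin s, 1 / ((q + (l + 1)).factorial : ℝ) * coeffA c i l
      = ∫ θ in (0 : ℝ)..1, (1 - θ) ^ q / (q.factorial : ℝ)
          * (Lagrange.basis Finset.univ c i).eval θ := by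
  have hdeg : (Lagrange.basis Finset.univ c i).natDegree < s := by
    rw [Polynomial.natDegree_eq_of_degree_eq_some
      (Lagrange.degree_basis hc.injOn (Finset.mem_univ i))]
    simpa using i.pos
  simp only [Polynomial.eval_eq_sum_range' hdeg, Finset.mul_sum]
  rw [intervalIntegral.integral_finsetSum
    (fun l _ => Continuous.intervalIntegrable (by fun_prop) _ _), Finset.sum_range]
  refine Finset.sum_congr rfl fun l _ => ?_
  have h : ∀ θ : ℝ, (1 - θ) ^ q / (q.factorial : ℝ)
      * ((Lagrange.basis Finset.univ c i).coeff l * θ ^ (l : ℕ))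
      = (Lagrange.basis Finset.univ c i).coeff l * ((1 - θ) ^ q / (q.factorial : ℝ) * θ ^ (l : ℕ)) :=
    fun θ => by ring
  simp only [h]
  rw [intervalIntegral.integral_const_mul, integral_one_sub_pow_mul_pow, coeffA]
  ring

/-- The difference between `θ^r` and its interpolation polynomial, times `(1-θ)^q`, vanishes at the
nodes and has degree `≤ q + r = m - 1` unless it is zero, so an exact quadrature gives the integral
zero. -/
lemma orderCoeff_eq_zero {s : ℕ} {c : Fin s → ℝ} (hc : Function.Injective c) {p m r : ℕ}
    (hq : QuadExact c p) (hr : r < m) (hm : m ≤ p) : orderCoeff c m r = 0 := by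
  obtain ⟨q, rfl⟩ : ∃ q, m = q + (r + 1) := ⟨m - r - 1, by omega⟩
  set I : Polynomial ℝ := Lagrange.interpolate Finset.univ c fun i => c i ^ r with hI
  set P : Polynomial ℝ := Polynomial.C (1 / (q.factorial : ℝ)) * (1 - Polynomial.X) ^ q
    * (Polynomial.X ^ r - I) with hP
  have hnode : ∀ i, P.eval (c i) = 0 := fun i => by
    have h := Lagrange.eval_interpolate_at_node (fun i => c i ^ r) hc.injOn (Finset.mem_univ i)
    rw [hP, hI, Polynomial.eval_mul, Polynomial.eval_sub, h]
    simp
  have hdeg : P.degree < (p : WithBot ℕ) := by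
    rcases lt_or_ge r s with hrs | hrs
    -- `θ^r` is its own interpolation polynomial
    · have h := Lagrange.eq_interpolate (s := Finset.univ) (v := c) hc.injOn
        (f := Polynomial.X ^ r) (by simpa using hrs)
      simp only [Polynomial.eval_pow, Polynomial.eval_X] at h
      rw [hP, hI, ← h, sub_self, mul_zero, Polynomial.degree_zero]
      exact WithBot.bot_lt_coe p
    · have h1 : (Polynomial.X ^ r - I).natDegree ≤ r := by
        refine Polynomial.natDegree_le_of_degree_le ?_
        refine (Polynomial.degree_sub_le _ _).trans (max_le (Polynomial.degree_X_pow_le r) ?_)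
        have h := Lagrange.degree_interpolate_lt (s := Finset.univ) (fun i => c i ^ r) hc.injOn
        rw [Finset.card_univ, Fintype.card_fin] at h
        exact h.le.trans (by exact_mod_cast hrs)
      have h2 : P.natDegree ≤ 0 + q * 1 + r := by
        refine Polynomial.natDegree_mul_le_of_le (Polynomial.natDegree_mul_le_of_le
          (Polynomial.natDegree_C _).le (Polynomial.natDegree_pow_le_of_le q ?_)) h1
        exact (Polynomial.natDegree_sub_le _ _).trans (by simp)
      exact Polynomial.degree_le_natDegree.trans_lt (by exact_mod_cast (by omega : P.natDegree < p))
  have hint := hq P hdeg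
  simp only [hnode, mul_zero, Finset.sum_const_zero] at hint
  have heval : ∀ θ : ℝ, P.eval θ = (1 - θ) ^ q / (q.factorial : ℝ) * θ ^ r
      - ∑ i, c i ^ r * ((1 - θ) ^ q / (q.factorial : ℝ)
        * (Lagrange.basis Finset.univ c i).eval θ) := fun θ => by
    simp only [hP, hI, Lagrange.interpolate_apply, Polynomial.eval_mul, Polynomial.eval_sub,
      Polynomial.eval_pow, Polynomial.eval_C, Polynomial.eval_X, Polynomial.eval_one,
      Polynomial.eval_finsetSum, mul_sub, Finset.mul_sum]
    congr 1
    · ring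
    · exact Finset.sum_congr rfl fun i _ => by ring
  simp only [heval] at hint
  have hcont : ∀ i, Continuous fun θ : ℝ => (Lagrange.basis Finset.univ c i).eval θ := fun i =>
    (Lagrange.basis Finset.univ c i).continuous
  rw [intervalIntegral.integral_sub (Continuous.intervalIntegrable (by fun_prop) _ _)
    (Continuous.intervalIntegrable (by fun_prop) _ _),
    intervalIntegral.integral_finsetSum
      (fun i _ => Continuous.intervalIntegrable (by fun_prop) _ _),
    integral_one_sub_pow_mul_pow] at hint
  simp only [intervalIntegral.integral_const_mul, ← sum_coeffA_div hc q] at hint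
  have hr0 : (r.factorial : ℝ) ≠ 0 := by positivity
  rw [orderCoeff, show q + (r + 1) - r - 1 = q by omega]
  have h : ∑ l : Fin s, 1 / ((q + (l + 1)).factorial : ℝ) * ∑ i, c i ^ r * coeffA c i l
      = (r.factorial : ℝ) / ((q + (r + 1)).factorial : ℝ) := by
    rw [sub_eq_zero.1 hint]
    simp only [Finset.mul_sum]
    rw [Finset.sum_comm]
    exact Finset.sum_congr rfl fun i _ => Finset.sum_congr rfl fun l _ => by ring
  rw [h]
  field_simp
  ring

end Order

end ExpQuad

end

/-! ### Bounds for the local errors -/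

theorem mainTheorem4
    {X Y Z : Type*}
    [NormedAddCommGroup X] [NormedSpace ℂ X] [CompleteSpace X]
    [NormedAddCommGroup Y] [NormedSpace ℂ Y] [CompleteSpace Y]
    [NormedAddCommGroup Z] [NormedSpace ℂ Z] [CompleteSpace Z]
    (A : X →ₗ.[ℂ] X) (bd : A.domain →ₗ[ℂ] Y) (S : ExpQuad.C0Semigroup X)
    (hA : ExpQuad.IsAbstractIBVP A bd S)
    (T : ℝ) (hT : 0 < T) (p : ℕ) (hp : 1 ≤ p)
    (f : ℝ → X) (g : ℝ → Y) (u₀ : X) (u : ℝ → X)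
    (hu : ExpQuad.IsSolution A bd T f g u₀ u)
    (hreg : ExpQuad.TimeRegular A T p u)
    {s : ℕ} (c : Fin s → ℝ) (hc : Function.Injective c) (hc01 : ∀ i, c i ∈ Set.Icc (0 : ℝ) 1)
    (ι : Z →L[ℂ] X) (hι : Function.Injective ι)
    (hZ : ExpQuad.IsCompatible (ExpQuad.kerRestrict A bd) S ι T p)
    (D : ℕ → ExpQuad.SpaceDisc X Y) (h ε : ℕ → ℝ)
    (hD : ExpQuad.IsSpaceDisc bd ι D h ε)
    (huZ : ExpQuad.ZRegular A ι T (p + 1) u)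
    (hfZ : ExpQuad.ZRegular A ι T p f) :
    (ExpQuad.PhBounded bd D →
      ∃ C : ℝ, ∀ (i n : ℕ) (k : ℝ), 0 < k → (n + 1) * k ≤ T → ∀ r : (D i).Xh0,
        ExpQuad.IsFullLocalError (D i) bd c p f u k n r →
          (D i).nrm0 r ≤ C * (k * ε i + ‖ExpQuad.rho A S c p f u k n‖)) ∧
    (∃ C : ℝ, ∀ (i n : ℕ) (k : ℝ), 0 < k → (n + 1) * k ≤ T → ∀ r : (D i).Xh0,
        ExpQuad.IsFullLocalError (D i) bd c p f u k n r →
          (D i).nrm0 r ≤ C * (k * ε i + ‖ExpQuad.rho A S c p f u k n‖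
            + ‖ExpQuad.bdry bd (ExpQuad.rho A S c p f u k n)‖)) ∧
    (∃ C : ℝ, ∀ (n : ℕ) (k : ℝ), 0 < k → (n + 1) * k ≤ T →
        ‖ExpQuad.rho A S c p f u k n
          - ∑ m ∈ Finset.Icc 1 p, k ^ m • ∑ r ∈ Finset.range m,
              (1 / (m.factorial : ℝ) - 1 / (r.factorial : ℝ) * ∑ l : Fin s,
                  1 / ((m - r - 1 + (l + 1)).factorial : ℝ)
                    * ∑ i, c i ^ r * ExpQuad.coeffA c i l)
                • (ExpQuad.app A)^[m - r - 1] (ExpQuad.tderiv T r f (n * k))‖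
          ≤ C * k ^ (p + 1)) ∧
    (ExpQuad.QuadExact c p →
      ∃ C : ℝ, ∀ (n : ℕ) (k : ℝ), 0 < k → (n + 1) * k ≤ T →
        ‖ExpQuad.rho A S c p f u k n‖ ≤ C * k ^ (p + 1)) := by
  obtain ⟨J, hJ⟩ := hA.exists_isKerInverse
  obtain ⟨M, hM⟩ := hD.exists_bounds
  have hM0 : 0 ≤ M := (hM 0).M_nonneg
  obtain ⟨C, hC0, hC⟩ := ExpQuad.exists_full_error_bound (bd := bd) hZ hι hJ hA.generator hp hu huZ
    hfZ hc01 hM0 hT.le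
  obtain ⟨C', hC'⟩ := ExpQuad.exists_rho_expansion hA.type_neg hu hreg hT hc01
  refine ⟨fun hP => ?_, ⟨C + M, fun i n k hk hn r hr => ?_⟩, ⟨C', hC'⟩, fun hq => ⟨C', ?_⟩⟩
  · obtain ⟨M', hM'⟩ := hP
    refine ⟨C + |M'|, fun i n k hk hn r hr => ?_⟩
    have hρ := ExpQuad.rho_mem (c := c) hJ hA.generator huZ hfZ hc01 hk hn
    have hε : 0 ≤ k * ε i := mul_nonneg hk.le (hD.eps_nonneg i)
    have h₁ := hC (D i) (ε i) (hM i) n k hk hn r hr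
    have h₂ : (D i).q ((D i).Ph bd (ExpQuad.rho A S c p f u k n))
        ≤ |M'| * ‖ExpQuad.rho A S c p f u k n‖ :=
      (hM' i _ hρ).trans (mul_le_mul_of_nonneg_right (le_abs_self M') (norm_nonneg _))
    have h₃ := mul_nonneg (abs_nonneg M') hε
    have h₄ := mul_nonneg hC0 (norm_nonneg (ExpQuad.rho A S c p f u k n))
    rw [← ExpQuad.SpaceDisc.q_apply]
    linarith
  · have hε : 0 ≤ k * ε i := mul_nonneg hk.le (hD.eps_nonneg i)
    have h₁ := hC (D i) (ε i) (hM i) n k hk hn r hr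
    -- the two parts of `P_h ρ_n = L_h ρ_n - L_h Q_h ∂ρ_n` are bounded separately
    have h₂ := map_sub_le_add (D i).q ((D i).Lh (ExpQuad.rho A S c p f u k n))
      ((D i).LQ (ExpQuad.bdry bd (ExpQuad.rho A S c p f u k n)))
    have h₃ := (hM i).Lh_le (ExpQuad.rho A S c p f u k n)
    have h₄ := (hM i).LQ_le (ExpQuad.bdry bd (ExpQuad.rho A S c p f u k n))
    have h₅ := mul_nonneg hM0 hε
    have h₆ := mul_nonneg hC0 (norm_nonneg (ExpQuad.rho A S c p f u k n))
    have h₇ := mul_nonneg hC0 (norm_nonneg (ExpQuad.bdry bd (ExpQuad.rho A S c p f u k n)))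
    rw [← ExpQuad.SpaceDisc.q_apply]
    rw [ExpQuad.SpaceDisc.Ph] at h₁
    linarith
  · intro n k hk hn
    have h := hC' n k hk hn
    rwa [Finset.sum_eq_zero fun m hm => ?_, sub_zero] at h
    rw [Finset.sum_eq_zero fun r hr => ?_, smul_zero]
    rw [ExpQuad.orderCoeff_eq_zero hc hq (Finset.mem_range.1 hr) (Finset.mem_Icc.1 hm).2, zero_smul]
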